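/- **Conventions.** Let $\mathbb O=\mathbb H\oplus\mathbb H$ be the octonions, with multiplication $(q_1,q_2)(p_1,p_2)=(q_1p_1-\bar p_2q_2,\;p_2q_1+q_2\bar p_1)$, conjugation $\overline{(q_1,q_2)}=(\bar q_1,-q_2)$, real part $\mathrm{Re}(q_1,q_2)=\mathrm{Re}\,q_1$ and norm $|a|^2=\mathrm{Re}(a\bar a)$. In $\mathbb O^3$ let $$U_1=\{(1,u,v): 1+|u|^2-|v|^2>0\},\qquad U_2=\{(u,1,v): |u|^2+1-|v|^2>0\}.$$ Write $(a,b,c)\sim(d,e,f)$ if $a=d\lambda$, $b=e\lambda$, $c=f\lambda$ for some $\lambda\in\mathbb O\setminus\{0\}$; this is an equivalence relation on $U_1\cup U_2$. The indefinite octonionic projective plane is the quotient $\mathbb OP^{(1,1)}=(U_1\cup U_2)/{\sim}$, with the quotient topology. It is a smooth $16$-dimensional manifold with the two charts $[1,u,v]\mapsto(u,v)$ on $U_1/{\sim}$ and $[u,1,v]\mapsto(u,v)$ on $U_2/{\sim}$. Let $U_3/{\sim}\subset\mathbb OP^{(1,1)}$ be the set of classes $[a,b,c]$ with $c\neq0$;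 its points are written $[x,y,1]$ with $x=ac^{-1}$, $y=bc^{-1}$, and $(x,y)$ ranges over $|x|^2+|y|^2>1$. An isometry of a semi-Riemannian manifold is a diffeomorphism of it onto itself whose differential preserves the metric. **Theorem.** 1. There is one and only one smooth semi-Riemannian metric (smooth field of symmetric nondegenerate bilinear forms on the tangent spaces) on $\mathbb OP^{(1,1)}$ which in each of the two charts $U_1/{\sim}$ and $U_2/{\sim}$, with coordinates $(u,v)$, is given by $$ds^2=\frac{|du|^2(1-|v|^2)-|dv|^2(1+|u|^2)+2\,\mathrm{Re}[(u\bar v)(dv\,d\bar u)]}{(1+|u|^2-|v|^2)^2}.$$ It has signature $(8,8)$ at every point. 2. For $r\in\mathbb R$ and $\lambda\in\mathbb O$ with $r^2-|\lambda|^2=1$, the "indefinite reflection" $(u,v)\mapsto(-ru+\lambda v,\;-\bar\lambda u+rv)$ of $U_1/{\sim}$, and likewise that of $U_2/{\sim}$, extends to one and only one isometry of $\mathbb OP^{(1,1)}$, and this isometry is an involution. For $r\in\mathbb R$ and $\lambda\in\mathbb O$ with $r^2+|\lambda|^2=1$, the "Euclidean reflection" $[x,y,1]\mapsto[rx+\lambda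 y,\;\bar\lambda x-ry,\;1]$ of $U_3/{\sim}$ extends to one and only one isometry of $\mathbb OP^{(1,1)}$, and this isometry is an involution. 3. The group generated by the isometries in part 2 acts transitively on $\mathbb OP^{(1,1)}$. In particular $\mathbb OP^{(1,1)}$ is homogeneous: its isometry group acts transitively. -/

import Mathlib

open scoped Quaternion Manifold ContDiff

noncomputable section

/-- The octonions as pairs of quaternions. The Euclidean structure on `ℍ ⊕ ℍ` is the one with
`|(q₁, q₂)|² = |q₁|² + |q₂|²`. -/
def Octonion : Type := WithLp 2 (ℍ[ℝ] × ℍ[ℝ])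

namespace Octonion

instance : NormedAddCommGroup Octonion := inferInstanceAs (NormedAddCommGroup (WithLp 2 (ℍ[ℝ] × ℍ[ℝ])))
instance : InnerProductSpace ℝ Octonion := inferInstanceAs (InnerProductSpace ℝ (WithLp 2 (ℍ[ℝ] × ℍ[ℝ])))
instance : FiniteDimensional ℝ Octonion :=
  inferInstanceAs (FiniteDimensional ℝ (WithLp 2 (ℍ[ℝ] × ℍ[ℝ])))

def mk (p q : ℍ[ℝ]) : Octonion := WithLp.toLp 2 (p, q)
def fst (a : Octonion) : ℍ[ℝ] := (WithLp.ofLp a).1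
def snd (a : Octonion) : ℍ[ℝ] := (WithLp.ofLp a).2

/-- Cayley–Dickson multiplication. -/
instance : Mul Octonion :=
  ⟨fun a b => mk (a.fst * b.fst - star b.snd * a.snd) (b.snd * a.fst + a.snd * star b.fst)⟩
instance : One Octonion := ⟨mk 1 0⟩
/-- Octonionic conjugation. -/
def conj (a : Octonion) : Octonion := mk (star a.fst) (-a.snd)
/-- The real part. -/
def re (a : Octonion) : ℝ := a.fst.re
/-- The inverse `a⁻¹ = |a|⁻² ā` (with `0⁻¹ = 0`). -/
instance : Inv Octonion := ⟨fun a => (‖a‖ ^ 2)⁻¹ • a.conj⟩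

theorem inv_def (a : Octonion) : a⁻¹ = (‖a‖ ^ 2)⁻¹ • a.conj := rfl

theorem ext' {a b : Octonion} (h₁ : a.fst = b.fst) (h₂ : a.snd = b.snd) : a = b :=
  WithLp.ofLp_injective 2 (Prod.ext h₁ h₂)

@[simp] theorem fst_mk (p q : ℍ[ℝ]) : (mk p q).fst = p := rfl
@[simp] theorem snd_mk (p q : ℍ[ℝ]) : (mk p q).snd = q := rfl
@[simp] theorem fst_mul (a b : Octonion) : (a * b).fst = a.fst * b.fst - star b.snd * a.snd := rfl
@[simp] theorem snd_mul (a b : Octonion) : (a * b).snd = b.snd * a.fst + a.snd * star b.fst := rfl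
@[simp] theorem fst_one : (1 : Octonion).fst = 1 := rfl
@[simp] theorem snd_one : (1 : Octonion).snd = 0 := rfl
@[simp] theorem fst_zero : (0 : Octonion).fst = 0 := rfl
@[simp] theorem snd_zero : (0 : Octonion).snd = 0 := rfl
@[simp] theorem fst_conj (a : Octonion) : a.conj.fst = star a.fst := rfl
@[simp] theorem snd_conj (a : Octonion) : a.conj.snd = -a.snd := rfl
@[simp] theorem fst_smul (r : ℝ) (a : Octonion) : (r • a).fst = r • a.fst := rfl
@[simp] theorem snd_smul (r : ℝ) (a : Octonion) : (r • a).snd = r • a.snd := rfl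
@[simp] theorem fst_add (a b : Octonion) : (a + b).fst = a.fst + b.fst := rfl
@[simp] theorem snd_add (a b : Octonion) : (a + b).snd = a.snd + b.snd := rfl

theorem norm_sq_eq (a : Octonion) : ‖a‖ ^ 2 =
    a.fst.re ^ 2 + a.fst.imI ^ 2 + a.fst.imJ ^ 2 + a.fst.imK ^ 2 +
    (a.snd.re ^ 2 + a.snd.imI ^ 2 + a.snd.imJ ^ 2 + a.snd.imK ^ 2) := by
  have h : ‖a‖ ^ 2 = ‖a.fst‖ ^ 2 + ‖a.snd‖ ^ 2 := WithLp.prod_norm_sq_eq_of_L2 a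
  rw [h, sq ‖a.fst‖, sq ‖a.snd‖, ← Quaternion.normSq_eq_norm_mul_self,
    ← Quaternion.normSq_eq_norm_mul_self, Quaternion.normSq_def', Quaternion.normSq_def']

/-- The norm agrees with `|a|² = Re (a ā)`. -/
theorem re_mul_conj_self (a : Octonion) : (a * a.conj).re = ‖a‖ ^ 2 := by
  rw [norm_sq_eq]; simp [re]; ring

theorem norm_sq_mul (a b : Octonion) : ‖a * b‖ ^ 2 = ‖a‖ ^ 2 * ‖b‖ ^ 2 := by
  simp only [norm_sq_eq]; simp; ring

theorem norm_mul' (a b : Octonion) : ‖a * b‖ = ‖a‖ * ‖b‖ := by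
  have h := norm_sq_mul a b
  rw [← mul_pow] at h
  exact (pow_left_inj₀ (norm_nonneg _) (by positivity) two_ne_zero).1 h

theorem mul_smul' (r : ℝ) (a b : Octonion) : a * (r • b) = r • (a * b) := by
  apply ext' <;> ext <;> simp <;> ring
theorem smul_mul' (r : ℝ) (a b : Octonion) : (r • a) * b = r • (a * b) := by
  apply ext' <;> ext <;> simp <;> ring

theorem one_mul' (a : Octonion) : 1 * a = a := by
  apply ext' <;> simp
theorem mul_one' (a : Octonion) : a * 1 = a := by
  apply ext' <;> simp
theorem zero_mul' (a : Octonion) : 0 * a = 0 := by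
  apply ext' <;> simp
theorem mul_zero' (a : Octonion) : a * 0 = 0 := by
  apply ext' <;> simp

theorem mul_mul_conj (a b : Octonion) : (a * b) * b.conj = ‖b‖ ^ 2 • a := by
  rw [norm_sq_eq]; apply ext' <;> ext <;> simp <;> ring
theorem mul_conj_mul (a b : Octonion) : (a * b.conj) * b = ‖b‖ ^ 2 • a := by
  rw [norm_sq_eq]; apply ext' <;> ext <;> simp <;> ring
theorem conj_mul_mul (a b : Octonion) : b.conj * (b * a) = ‖b‖ ^ 2 • a := by
  rw [norm_sq_eq]; apply ext' <;> ext <;> simp <;> ring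
theorem conj_mul (a b : Octonion) : (a * b).conj = b.conj * a.conj := by
  apply ext' <;> ext <;> simp
theorem conj_conj (a : Octonion) : a.conj.conj = a := by apply ext' <;> simp
theorem norm_conj (a : Octonion) : ‖a.conj‖ = ‖a‖ := by
  have h : ‖a.conj‖ ^ 2 = ‖a‖ ^ 2 := by simp [norm_sq_eq]
  exact (pow_left_inj₀ (norm_nonneg _) (norm_nonneg _) two_ne_zero).1 h

theorem norm_sq_ne {a : Octonion} (h : a ≠ 0) : ‖a‖ ^ 2 ≠ 0 := by simpa using h

theorem norm_one' : ‖(1 : Octonion)‖ = 1 := by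
  have h : ‖(1 : Octonion)‖ ^ 2 = 1 ^ 2 := by simp [norm_sq_eq]
  exact (pow_left_inj₀ (norm_nonneg _) zero_le_one two_ne_zero).1 h
theorem one_ne_zero' : (1 : Octonion) ≠ 0 := by
  rw [← norm_ne_zero_iff, norm_one']; exact one_ne_zero
theorem inv_zero' : (0 : Octonion)⁻¹ = 0 := by simp [inv_def]
theorem norm_inv' (a : Octonion) : ‖a⁻¹‖ = ‖a‖⁻¹ := by
  by_cases h : a = 0
  · subst h; simp [inv_zero']
  · have := norm_ne_zero_iff.2 h
    rw [inv_def, norm_smul, norm_conj]; simp; field_simp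
theorem inv_inv' (a : Octonion) : a⁻¹⁻¹ = a := by
  by_cases h : a = 0
  · subst h; simp [inv_zero']
  · have h0 := norm_ne_zero_iff.2 h
    rw [inv_def, norm_inv', inv_def]
    have : ((‖a‖ ^ 2)⁻¹ • a.conj).conj = (‖a‖ ^ 2)⁻¹ • a := by
      apply ext' <;> ext <;> simp
    rw [this, smul_smul]
    have : (‖a‖⁻¹ ^ 2)⁻¹ * (‖a‖ ^ 2)⁻¹ = 1 := by field_simp
    rw [this, one_smul]
theorem inv_one' : (1 : Octonion)⁻¹ = 1 := by
  rw [inv_def, norm_one']; apply ext' <;> simp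
theorem inv_ne_zero' {a : Octonion} (h : a ≠ 0) : a⁻¹ ≠ 0 := by
  rw [← norm_ne_zero_iff, norm_inv']; exact inv_ne_zero (norm_ne_zero_iff.2 h)
theorem mul_mul_inv (a : Octonion) {b : Octonion} (h : b ≠ 0) : (a * b) * b⁻¹ = a := by
  rw [inv_def, mul_smul', mul_mul_conj, smul_smul, inv_mul_cancel₀ (norm_sq_ne h), one_smul]
theorem mul_inv_mul (a : Octonion) {b : Octonion} (h : b ≠ 0) : (a * b⁻¹) * b = a := by
  rw [inv_def, mul_smul', smul_mul', mul_conj_mul, smul_smul, inv_mul_cancel₀ (norm_sq_ne h),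
    one_smul]
theorem inv_mul_mul (a : Octonion) {b : Octonion} (h : b ≠ 0) : b⁻¹ * (b * a) = a := by
  rw [inv_def, smul_mul', conj_mul_mul, smul_smul, inv_mul_cancel₀ (norm_sq_ne h), one_smul]
theorem mul_inv_self {b : Octonion} (h : b ≠ 0) : b * b⁻¹ = 1 := by
  simpa [one_mul'] using mul_mul_inv 1 h
theorem inv_mul_self {b : Octonion} (h : b ≠ 0) : b⁻¹ * b = 1 := by
  simpa [one_mul'] using mul_inv_mul 1 h
theorem mul_inv_rev' (a b : Octonion) : (a * b)⁻¹ = b⁻¹ * a⁻¹ := by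
  simp only [inv_def, norm_sq_mul, conj_mul, mul_smul', smul_mul', smul_smul, mul_inv]

theorem contDiff_fst {n : WithTop ℕ∞} : ContDiff ℝ n fst :=
  (LinearMap.toContinuousLinearMap
    ({ toFun := fst, map_add' := fun _ _ => rfl, map_smul' := fun _ _ => rfl } :
      Octonion →ₗ[ℝ] ℍ[ℝ])).contDiff
theorem contDiff_snd {n : WithTop ℕ∞} : ContDiff ℝ n snd :=
  (LinearMap.toContinuousLinearMap
    ({ toFun := snd, map_add' := fun _ _ => rfl, map_smul' := fun _ _ => rfl } :
      Octonion →ₗ[ℝ] ℍ[ℝ])).contDiff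
theorem contDiff_mk {n : WithTop ℕ∞} : ContDiff ℝ n fun p : ℍ[ℝ] × ℍ[ℝ] => mk p.1 p.2 :=
  (LinearMap.toContinuousLinearMap
    ({ toFun := fun p => mk p.1 p.2, map_add' := fun _ _ => rfl, map_smul' := fun _ _ => rfl } :
      ℍ[ℝ] × ℍ[ℝ] →ₗ[ℝ] Octonion)).contDiff
theorem contDiff_starQ {n : WithTop ℕ∞} : ContDiff ℝ n (star : ℍ[ℝ] → ℍ[ℝ]) :=
  (LinearMap.toContinuousLinearMap
    ({ toFun := star, map_add' := star_add, map_smul' := fun r q => Quaternion.star_smul r q } :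
      ℍ[ℝ] →ₗ[ℝ] ℍ[ℝ])).contDiff

theorem contDiff_mul' {n : WithTop ℕ∞} : ContDiff ℝ n fun p : Octonion × Octonion => p.1 * p.2 := by
  have h1 := contDiff_fst (n := n).comp (_root_.contDiff_fst (𝕜 := ℝ) (E := Octonion) (F := Octonion))
  have h2 := contDiff_snd (n := n).comp (_root_.contDiff_fst (𝕜 := ℝ) (E := Octonion) (F := Octonion))
  have h3 := contDiff_fst (n := n).comp (_root_.contDiff_snd (𝕜 := ℝ) (E := Octonion) (F := Octonion))
  have h4 := contDiff_snd (n := n).comp (_root_.contDiff_snd (𝕜 := ℝ) (E := Octonion) (F := Octonion))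
  exact contDiff_mk.comp (((h1.mul h3).sub ((contDiff_starQ.comp h4).mul h2)).prodMk
    ((h4.mul h1).add (h2.mul (contDiff_starQ.comp h3))))

theorem contDiff_conj {n : WithTop ℕ∞} : ContDiff ℝ n conj :=
  contDiff_mk.comp ((contDiff_starQ.comp contDiff_fst).prodMk contDiff_snd.neg)

theorem contDiffAt_inv' {n : WithTop ℕ∞} {a : Octonion} (h : a ≠ 0) :
    ContDiffAt ℝ n (fun x : Octonion => x⁻¹) a :=
  ((contDiff_norm_sq ℝ).contDiffAt.inv (norm_sq_ne h)).smul contDiff_conj.contDiffAt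

theorem continuous_mul' : Continuous fun p : Octonion × Octonion => p.1 * p.2 :=
  (contDiff_mul' (n := 0)).continuous
theorem continuousAt_inv' {a : Octonion} (h : a ≠ 0) :
    ContinuousAt (fun x : Octonion => x⁻¹) a :=
  (contDiffAt_inv' (n := 0) h).continuousAt

end Octonion

/-- The model space `𝕆²` of the charts. -/
abbrev OctPair : Type := Octonion × Octonion

namespace OP11
open Octonion

/-- `U₁ = {(1, u, v) : 1 + |u|² - |v|² > 0}`. -/
def U₁ : Set (Octonion × Octonion × Octonion) :=
  {x | x.1 = 1 ∧ 0 < 1 + ‖x.2.1‖ ^ 2 - ‖x.2.2‖ ^ 2}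
/-- `U₂ = {(u, 1, v) : |u|² + 1 - |v|² > 0}`. -/
def U₂ : Set (Octonion × Octonion × Octonion) :=
  {x | x.2.1 = 1 ∧ 0 < ‖x.1‖ ^ 2 + 1 - ‖x.2.2‖ ^ 2}
/-- The space of reduced homogeneous coordinates, a subspace of `𝕆³`. -/
abbrev Coords : Type := ↥(U₁ ∪ U₂)

/-- `[a,b,c] ∼ [d,e,f]` iff `a = dλ`, `b = eλ`, `c = fλ` for some `λ ≠ 0`. -/
def Rel (x y : Octonion × Octonion × Octonion) : Prop :=
  ∃ l : Octonion, l ≠ 0 ∧ x.1 = y.1 * l ∧ x.2.1 = y.2.1 * l ∧ x.2.2 = y.2.2 * l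

theorem rel_refl (x) : Rel x x := ⟨1, one_ne_zero', by simp [mul_one']⟩

theorem rel_symm {x y} (h : Rel x y) : Rel y x := by
  obtain ⟨l, hl, h1, h2, h3⟩ := h
  exact ⟨l⁻¹, inv_ne_zero' hl, by rw [h1, mul_mul_inv _ hl], by rw [h2, mul_mul_inv _ hl],
    by rw [h3, mul_mul_inv _ hl]⟩

/-- Two distinct equivalent elements are of the form `(1, u, v)` and `(u⁻¹, 1, v u⁻¹)`. -/
theorem rel_cases {x y : Octonion × Octonion × Octonion} (hx : x ∈ U₁ ∪ U₂) (hy : y ∈ U₁ ∪ U₂)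
    (h : Rel x y) : x = y ∨ ∃ u v : Octonion, u ≠ 0 ∧
      ((x = (1, u, v) ∧ y = (u⁻¹, 1, v * u⁻¹)) ∨ (y = (1, u, v) ∧ x = (u⁻¹, 1, v * u⁻¹))) := by
  obtain ⟨a, b, c⟩ := x
  obtain ⟨d, e, f⟩ := y
  obtain ⟨l, hl, h1, h2, h3⟩ := h
  simp only at h1 h2 h3
  rcases hx with ⟨hx, -⟩ | ⟨hx, -⟩ <;> rcases hy with ⟨hy, -⟩ | ⟨hy, -⟩ <;>
    simp only at hx hy <;> subst hx hy
  · have : l = 1 := by rw [h1, one_mul']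
    subst this; left; simp [h2, h3, mul_one']
  · right
    refine ⟨l, c, hl, Or.inl ⟨by rw [h2, one_mul'], ?_⟩⟩
    have e1 : d = l⁻¹ := by rw [← mul_mul_inv d hl, ← h1, one_mul']
    rw [h3, mul_mul_inv _ hl, e1]
  · right
    have e1 : e = l⁻¹ := by rw [← mul_mul_inv e hl, ← h2, one_mul']
    refine ⟨l⁻¹, f, inv_ne_zero' hl, Or.inr ⟨by rw [e1], ?_⟩⟩
    rw [inv_inv', h3, h1, one_mul']
  · have : l = 1 := by rw [h2, one_mul']
    subst this; left; simp [h1, h3, mul_one']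

theorem rel_trans {x y z : Octonion × Octonion × Octonion} (hx : x ∈ U₁ ∪ U₂) (hy : y ∈ U₁ ∪ U₂)
    (hz : z ∈ U₁ ∪ U₂) (h : Rel x y) (h' : Rel y z) : Rel x z := by
  rcases rel_cases hx hy h with rfl | ⟨u, v, hu, ⟨e1, e2⟩ | ⟨e1, e2⟩⟩
  · exact h'
  · rcases rel_cases hy hz h' with rfl | ⟨u', v', hu', ⟨e3, e4⟩ | ⟨e3, e4⟩⟩
    · exact h
    · have hu1 : u = 1 := by
        have : u⁻¹ = 1 := by simpa using congrArg Prod.fst (e2.symm.trans e3)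
        rw [← inv_inv' u, this, inv_one']
      have : x = y := by rw [e1, e2, hu1, inv_one', mul_one']
      rwa [this]
    · have e5 := e2.symm.trans e4
      simp only [Prod.mk.injEq, true_and] at e5
      have hu1 : u = u' := by rw [← inv_inv' u, e5.1, inv_inv']
      subst hu1
      have : v = v' := by rw [← mul_inv_mul v hu, e5.2, mul_inv_mul v' hu]
      subst this
      rw [e1, e3]; exact rel_refl _
  · rcases rel_cases hy hz h' with rfl | ⟨u', v', hu', ⟨e3, e4⟩ | ⟨e3, e4⟩⟩
    · exact h
    · have e5 := e1.symm.trans e3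
      simp only [Prod.mk.injEq, true_and] at e5
      rw [e2, e4, e5.1, e5.2]; exact rel_refl _
    · have hu1 : u = 1 := by
        simpa using congrArg (fun p => p.2.1) (e1.symm.trans e4)
      have : x = y := by rw [e1, e2, hu1, inv_one', mul_one']
      rwa [this]

/-- The relation `∼` on `U₁ ∪ U₂` is an equivalence relation. -/
instance relSetoid : Setoid Coords where
  r x y := Rel x.1 y.1
  iseqv := ⟨fun x => rel_refl x.1, fun h => rel_symm h,
    fun {x y z} h h' => rel_trans x.2 y.2 z.2 h h'⟩

end OP11

/-- The indefinite octonionic projective plane, with the quotient topology. -/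
def OP11 : Type := Quotient OP11.relSetoid

namespace OP11
open Octonion

instance : TopologicalSpace OP11 := inferInstanceAs (TopologicalSpace (Quotient relSetoid))

/-- The class `[a, b, c]`. -/
def cls (x : Coords) : OP11 := Quotient.mk relSetoid x

theorem isQuotientMap_cls : Topology.IsQuotientMap cls := isQuotientMap_quotient_mk'

theorem ind {P : OP11 → Prop} (h : ∀ x, P (cls x)) (p) : P p := Quotient.ind h p

theorem cls_eq {x y : Coords} : cls x = cls y ↔ Rel x.1 y.1 := Quotient.eq

/-- `U₁/∼`, the set of classes of elements of `U₁`. -/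
def D₁ : Set OP11 := cls '' {x | x.1 ∈ U₁}
/-- `U₂/∼`, the set of classes of elements of `U₂`. -/
def D₂ : Set OP11 := cls '' {x | x.1 ∈ U₂}
/-- `U₃/∼`, the set of classes `[a, b, c]` with `c ≠ 0`. -/
def D₃ : Set OP11 := cls '' {x | x.1.2.2 ≠ 0}

theorem lift_aux {f : Octonion × Octonion × Octonion → OctPair}
    (hf : ∀ u v : Octonion, u ≠ 0 → f (1, u, v) = f (u⁻¹, 1, v * u⁻¹)) (x y : Coords)
    (h : Rel x.1 y.1) : f x.1 = f y.1 := by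
  rcases rel_cases x.2 y.2 h with e | ⟨u, v, hu, ⟨e1, e2⟩ | ⟨e1, e2⟩⟩
  · rw [e]
  · rw [e1, e2, hf u v hu]
  · rw [e1, e2, hf u v hu]

/-- The coordinates on `U₁/∼`: `[1, u, v] ↦ (u, v)`; in general `[a, b, c] ↦ (b a⁻¹, c a⁻¹)`. -/
def φ₁ (p : OP11) : OctPair :=
  Quotient.lift (fun x : Coords => ((x.1.2.1 * x.1.1⁻¹, x.1.2.2 * x.1.1⁻¹) : OctPair))
    (lift_aux (f := fun x => (x.2.1 * x.1⁻¹, x.2.2 * x.1⁻¹)) (fun u v hu => by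
      simp [inv_one', mul_one', one_mul', inv_inv', mul_inv_mul _ hu])) p

/-- The coordinates on `U₂/∼`: `[u, 1, v] ↦ (u, v)`; in general `[a, b, c] ↦ (a b⁻¹, c b⁻¹)`. -/
def φ₂ (p : OP11) : OctPair :=
  Quotient.lift (fun x : Coords => ((x.1.1 * x.1.2.1⁻¹, x.1.2.2 * x.1.2.1⁻¹) : OctPair))
    (lift_aux (f := fun x => (x.1 * x.2.1⁻¹, x.2.2 * x.2.1⁻¹)) (fun u v hu => by
      simp [inv_one', mul_one', one_mul'])) p

/-- The coordinates on `U₃/∼`: `[x, y, 1] ↦ (x, y)`; in general `[a, b, c] ↦ (a c⁻¹, b c⁻¹)`. -/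
def φ₃ (p : OP11) : OctPair :=
  Quotient.lift (fun x : Coords => ((x.1.1 * x.1.2.2⁻¹, x.1.2.1 * x.1.2.2⁻¹) : OctPair))
    (lift_aux (f := fun x => (x.1 * x.2.2⁻¹, x.2.1 * x.2.2⁻¹)) (fun u v hu => by
      simp [one_mul', mul_inv_rev', inv_inv', inv_mul_mul _ hu])) p

theorem φ₁_cls (x : Coords) : φ₁ (cls x) = (x.1.2.1 * x.1.1⁻¹, x.1.2.2 * x.1.1⁻¹) := rfl
theorem φ₂_cls (x : Coords) : φ₂ (cls x) = (x.1.1 * x.1.2.1⁻¹, x.1.2.2 * x.1.2.1⁻¹) := rfl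
theorem φ₃_cls (x : Coords) : φ₃ (cls x) = (x.1.1 * x.1.2.2⁻¹, x.1.2.1 * x.1.2.2⁻¹) := rfl

/-- The common coordinate domain `{(u, v) : 1 + |u|² - |v|² > 0}` of `U₁/∼` and `U₂/∼`. -/
def target : Set OctPair := {w | 0 < 1 + ‖w.1‖ ^ 2 - ‖w.2‖ ^ 2}

theorem isOpen_target : IsOpen target :=
  isOpen_lt continuous_const (by fun_prop)

/-- The point `[1, u, v]`. -/
def pt₁ (w : target) : OP11 := cls ⟨(1, w.1.1, w.1.2), Or.inl ⟨rfl, w.2⟩⟩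
/-- The point `[u, 1, v]`. -/
def pt₂ (w : target) : OP11 := cls ⟨(w.1.1, 1, w.1.2), Or.inr ⟨rfl, by
  have := w.2; simp only [target, Set.mem_ofPred_eq] at this; dsimp only; linarith⟩⟩

theorem zero_mem_target : (0 : OctPair) ∈ target := by simp [target]

open Classical in
/-- Inverse of `φ₁`, with an irrelevant value outside `target`. -/
def ψ₁ (w : OctPair) : OP11 := if h : w ∈ target then pt₁ ⟨w, h⟩ else pt₁ ⟨0, zero_mem_target⟩
open Classical in
/-- Inverse of `φ₂`, with an irrelevant value outside `target`. -/
def ψ₂ (w : OctPair) : OP11 := if h : w ∈ target then pt₂ ⟨w, h⟩ else pt₂ ⟨0, zero_mem_target⟩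

theorem φ₁_pt₁ (w : target) : φ₁ (pt₁ w) = w.1 := by
  rw [pt₁, φ₁_cls]; simp [inv_one', mul_one']
theorem φ₂_pt₂ (w : target) : φ₂ (pt₂ w) = w.1 := by
  rw [pt₂, φ₂_cls]; simp [inv_one', mul_one']

theorem mem_D₁ {p : OP11} : p ∈ D₁ ↔ ∃ w, p = pt₁ w := by
  constructor
  · rintro ⟨⟨⟨a, b, c⟩, hx⟩, ⟨h, h'⟩, rfl⟩
    simp only at h h'; subst h
    exact ⟨⟨(b, c), h'⟩, rfl⟩
  · rintro ⟨w, rfl⟩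
    exact ⟨⟨(1, w.1.1, w.1.2), Or.inl ⟨rfl, w.2⟩⟩, ⟨rfl, w.2⟩, rfl⟩

theorem mem_D₂ {p : OP11} : p ∈ D₂ ↔ ∃ w, p = pt₂ w := by
  constructor
  · rintro ⟨⟨⟨a, b, c⟩, hx⟩, ⟨h, h'⟩, rfl⟩
    simp only at h h'; subst h
    exact ⟨⟨(a, c), by simp only [target, Set.mem_ofPred_eq]; linarith⟩, rfl⟩
  · rintro ⟨w, rfl⟩
    refine ⟨_, ⟨rfl, ?_⟩, rfl⟩
    have := w.2; simp only [target, Set.mem_ofPred_eq] at this; dsimp only; linarith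

theorem trans_mem {u v : Octonion} (hu : u ≠ 0) (h : (u, v) ∈ target) :
    (u⁻¹, v * u⁻¹) ∈ target := by
  simp only [target, Set.mem_ofPred_eq, norm_mul', norm_inv'] at h ⊢
  have h0 := norm_pos_iff.2 hu
  have : 1 + ‖u‖⁻¹ ^ 2 - (‖v‖ * ‖u‖⁻¹) ^ 2 = (1 + ‖u‖ ^ 2 - ‖v‖ ^ 2) / ‖u‖ ^ 2 := by
    field_simp; ring
  rw [this]; positivity

theorem pt₁_eq_pt₂ {u v : Octonion} (hu : u ≠ 0) (h : (u, v) ∈ target) :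
    pt₁ ⟨(u, v), h⟩ = pt₂ ⟨(u⁻¹, v * u⁻¹), trans_mem hu h⟩ :=
  cls_eq.2 ⟨u, hu, by simp [inv_mul_self hu], by simp [one_mul'], by simp [mul_inv_mul _ hu]⟩

theorem pt₂_eq_pt₁ {u v : Octonion} (hu : u ≠ 0) (h : (u, v) ∈ target) :
    pt₂ ⟨(u, v), h⟩ = pt₁ ⟨(u⁻¹, v * u⁻¹), trans_mem hu h⟩ :=
  cls_eq.2 ⟨u, hu, by simp [one_mul'], by simp [inv_mul_self hu], by simp [mul_inv_mul _ hu]⟩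

theorem cls_mem_D₁ {x : Coords} : cls x ∈ D₁ ↔ x.1.1 ≠ 0 := by
  obtain ⟨⟨a, b, c⟩, hx⟩ := x
  constructor
  · rintro ⟨y, ⟨hy, -⟩, h⟩ h0
    obtain ⟨l, hl, h1, -⟩ := cls_eq.1 h
    rw [hy, h0, zero_mul'] at h1
    exact one_ne_zero' h1
  · intro h
    rcases hx with hx | ⟨hx, hx'⟩
    · exact ⟨_, hx, rfl⟩
    · simp only at hx hx' h; subst hx
      have ht : (a, c) ∈ target := by simp only [target, Set.mem_ofPred_eq]; linarith
      exact mem_D₁.2 ⟨_, pt₂_eq_pt₁ h ht⟩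

theorem cls_mem_D₂ {x : Coords} : cls x ∈ D₂ ↔ x.1.2.1 ≠ 0 := by
  obtain ⟨⟨a, b, c⟩, hx⟩ := x
  constructor
  · rintro ⟨y, ⟨hy, -⟩, h⟩ h0
    obtain ⟨l, hl, -, h1, -⟩ := cls_eq.1 h
    rw [hy, h0, zero_mul'] at h1
    exact one_ne_zero' h1
  · intro h
    rcases hx with ⟨hx, hx'⟩ | hx
    · simp only at hx hx' h; subst hx
      exact mem_D₂.2 ⟨_, pt₁_eq_pt₂ h hx'⟩
    · exact ⟨_, hx, rfl⟩

theorem isOpen_D₁ : IsOpen D₁ := by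
  rw [← isQuotientMap_cls.isOpen_preimage]
  have : cls ⁻¹' D₁ = {x | x.1.1 ≠ 0} := by ext x; exact cls_mem_D₁
  rw [this]
  exact isOpen_ne_fun (by fun_prop) continuous_const

theorem isOpen_D₂ : IsOpen D₂ := by
  rw [← isQuotientMap_cls.isOpen_preimage]
  have : cls ⁻¹' D₂ = {x | x.1.2.1 ≠ 0} := by ext x; exact cls_mem_D₂
  rw [this]
  exact isOpen_ne_fun (by fun_prop) continuous_const

theorem continuousOn_lift {s : Set OP11} (hs : IsOpen s) {f : OP11 → OctPair}
    (h : ∀ x : Coords, cls x ∈ s → ContinuousAt (fun x => f (cls x)) x) : ContinuousOn f s := by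
  rw [isQuotientMap_cls.continuousOn_isOpen_iff hs]
  intro x hx
  exact (h x hx).continuousWithinAt

theorem continuousAt_quot {x : Coords} {f g : Coords → Octonion} (hf : Continuous f)
    (hg : Continuous g) (h : g x ≠ 0) : ContinuousAt (fun x => f x * (g x)⁻¹) x := by
  have h1 : ContinuousAt (fun x => (g x)⁻¹) x := (continuousAt_inv' h).comp hg.continuousAt
  have h2 : ContinuousAt (fun x => (f x, (g x)⁻¹)) x := hf.continuousAt.prodMk h1
  have h3 := ContinuousAt.comp' continuous_mul'.continuousAt h2
  exact h3

theorem continuousOn_φ₁ : ContinuousOn φ₁ D₁ := by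
  refine continuousOn_lift isOpen_D₁ fun x hx => ?_
  have h := cls_mem_D₁.1 hx
  exact (continuousAt_quot (by fun_prop) (by fun_prop) h).prodMk
    (continuousAt_quot (by fun_prop) (by fun_prop) h)

theorem continuousOn_φ₂ : ContinuousOn φ₂ D₂ := by
  refine continuousOn_lift isOpen_D₂ fun x hx => ?_
  have h := cls_mem_D₂.1 hx
  exact (continuousAt_quot (by fun_prop) (by fun_prop) h).prodMk
    (continuousAt_quot (by fun_prop) (by fun_prop) h)

theorem continuous_pt₁ : Continuous pt₁ :=
  isQuotientMap_cls.continuous.comp (Continuous.subtype_mk (by fun_prop) _)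
theorem continuous_pt₂ : Continuous pt₂ :=
  isQuotientMap_cls.continuous.comp (Continuous.subtype_mk (by fun_prop) _)

theorem ψ₁_of_mem {w : OctPair} (h : w ∈ target) : ψ₁ w = pt₁ ⟨w, h⟩ := dif_pos h
theorem ψ₂_of_mem {w : OctPair} (h : w ∈ target) : ψ₂ w = pt₂ ⟨w, h⟩ := dif_pos h

/-- The chart `[1, u, v] ↦ (u, v)` on `U₁/∼`. -/
def chart₁ : OpenPartialHomeomorph OP11 OctPair where
  toFun := φ₁
  invFun := ψ₁
  source := D₁
  target := target
  map_source' p hp := by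
    obtain ⟨w, rfl⟩ := mem_D₁.1 hp
    rw [φ₁_pt₁]; exact w.2
  map_target' w hw := mem_D₁.2 ⟨_, ψ₁_of_mem hw⟩
  left_inv' p hp := by
    obtain ⟨w, rfl⟩ := mem_D₁.1 hp
    rw [φ₁_pt₁, ψ₁_of_mem w.2]
  right_inv' w hw := by rw [ψ₁_of_mem hw, φ₁_pt₁]
  open_source := isOpen_D₁
  open_target := isOpen_target
  continuousOn_toFun := continuousOn_φ₁
  continuousOn_invFun := by
    rw [continuousOn_iff_continuous_domRestrict]
    exact continuous_pt₁.congr fun w => (ψ₁_of_mem w.2).symm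

/-- The chart `[u, 1, v] ↦ (u, v)` on `U₂/∼`. -/
def chart₂ : OpenPartialHomeomorph OP11 OctPair where
  toFun := φ₂
  invFun := ψ₂
  source := D₂
  target := target
  map_source' p hp := by
    obtain ⟨w, rfl⟩ := mem_D₂.1 hp
    rw [φ₂_pt₂]; exact w.2
  map_target' w hw := mem_D₂.2 ⟨_, ψ₂_of_mem hw⟩
  left_inv' p hp := by
    obtain ⟨w, rfl⟩ := mem_D₂.1 hp
    rw [φ₂_pt₂, ψ₂_of_mem w.2]
  right_inv' w hw := by rw [ψ₂_of_mem hw, φ₂_pt₂]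
  open_source := isOpen_D₂
  open_target := isOpen_target
  continuousOn_toFun := continuousOn_φ₂
  continuousOn_invFun := by
    rw [continuousOn_iff_continuous_domRestrict]
    exact continuous_pt₂.congr fun w => (ψ₂_of_mem w.2).symm

theorem mem_D₁_or_D₂ (p : OP11) : p ∈ D₁ ∨ p ∈ D₂ := by
  induction p using ind with
  | h x => exact x.2.imp (fun h => ⟨x, h, rfl⟩) (fun h => ⟨x, h, rfl⟩)

open Classical in
instance : ChartedSpace OctPair OP11 where
  atlas := {chart₁, chart₂}
  chartAt p := if p ∈ D₁ then chart₁ else chart₂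
  mem_chart_source p := by
    split_ifs with h
    · exact h
    · exact (mem_D₁_or_D₂ p).resolve_left h
  chart_mem_atlas p := by split_ifs <;> simp

theorem contDiffAt_trans {n : WithTop ℕ∞} {w : OctPair} (h : w.1 ≠ 0) :
    ContDiffAt ℝ n (fun w : OctPair => (w.1⁻¹, w.2 * w.1⁻¹)) w := by
  have h1 : ContDiffAt ℝ n (fun w : OctPair => w.1⁻¹) w := (contDiffAt_inv' h).comp w contDiffAt_fst
  have h2 : ContDiffAt ℝ n (fun w : OctPair => (w.2, w.1⁻¹)) w := contDiffAt_snd.prodMk h1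
  have h3 := contDiff_mul'.contDiffAt.comp w h2
  exact h1.prodMk h3

theorem contDiffOn_trans₁₂ {n : WithTop ℕ∞} :
    ContDiffOn ℝ n (chart₁.symm.trans chart₂) (chart₁.symm.trans chart₂).source := by
  rintro ⟨u, v⟩ ⟨hw, hw'⟩
  have hu : u ≠ 0 := by
    have h1 : ψ₁ (u, v) ∈ D₂ := hw'
    rw [ψ₁_of_mem hw] at h1
    exact cls_mem_D₂.1 h1
  refine (contDiffAt_trans hu).contDiffWithinAt.congr_of_mem ?_ ⟨hw, hw'⟩
  rintro w ⟨hw, hw'⟩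
  change φ₂ (ψ₁ w) = _
  rw [ψ₁_of_mem hw, pt₁, φ₂_cls]
  simp [one_mul']

theorem contDiffOn_trans₂₁ {n : WithTop ℕ∞} :
    ContDiffOn ℝ n (chart₂.symm.trans chart₁) (chart₂.symm.trans chart₁).source := by
  rintro ⟨u, v⟩ ⟨hw, hw'⟩
  have hu : u ≠ 0 := by
    have h1 : ψ₂ (u, v) ∈ D₁ := hw'
    rw [ψ₂_of_mem hw] at h1
    exact cls_mem_D₁.1 h1
  refine (contDiffAt_trans hu).contDiffWithinAt.congr_of_mem ?_ ⟨hw, hw'⟩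
  rintro w ⟨hw, hw'⟩
  change φ₁ (ψ₂ w) = _
  rw [ψ₂_of_mem hw, pt₂, φ₁_cls]
  simp [one_mul']

/-- The transition maps are smooth (even analytic). -/
instance {n : WithTop ℕ∞} : IsManifold 𝓘(ℝ, OctPair) n OP11 := by
  apply isManifold_of_contDiffOn
  have aux : ∀ e : OpenPartialHomeomorph OP11 OctPair,
      ContDiffOn ℝ n (e.symm.trans e) (e.symm.trans e).source := fun e =>
    contDiffOn_id.congr fun w hw => e.right_inv hw.1
  rintro e e' (rfl | rfl) (rfl | rfl)
  · simpa using aux chart₁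
  · simpa using contDiffOn_trans₁₂
  · simpa using contDiffOn_trans₂₁
  · simpa using aux chart₂

end OP11

namespace OP11
open Octonion

theorem isOpen_lt_norm : IsOpen (cls '' {x | ‖x.1.2.1‖ < ‖x.1.1‖}) ∧
    IsOpen (cls '' {x | ‖x.1.1‖ < ‖x.1.2.1‖}) := by
  constructor
  · rw [← isQuotientMap_cls.isOpen_preimage]
    have : cls ⁻¹' (cls '' {x | ‖x.1.2.1‖ < ‖x.1.1‖}) = {x | ‖x.1.2.1‖ < ‖x.1.1‖} := by
      ext x
      constructor
      · rintro ⟨y, hy, h⟩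
        obtain ⟨l, hl, h1, h2, -⟩ := cls_eq.1 h
        simp only [Set.mem_ofPred_eq, h1, h2, norm_mul'] at hy ⊢
        exact lt_of_mul_lt_mul_right hy (norm_nonneg l)
      · exact fun h => ⟨x, h, rfl⟩
    rw [this]
    exact isOpen_lt (by fun_prop) (by fun_prop)
  · rw [← isQuotientMap_cls.isOpen_preimage]
    have : cls ⁻¹' (cls '' {x | ‖x.1.1‖ < ‖x.1.2.1‖}) = {x | ‖x.1.1‖ < ‖x.1.2.1‖} := by
      ext x
      constructor
      · rintro ⟨y, hy, h⟩
        obtain ⟨l, hl, h1, h2, -⟩ := cls_eq.1 h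
        simp only [Set.mem_ofPred_eq, h1, h2, norm_mul'] at hy ⊢
        exact lt_of_mul_lt_mul_right hy (norm_nonneg l)
      · exact fun h => ⟨x, h, rfl⟩
    rw [this]
    exact isOpen_lt (by fun_prop) (by fun_prop)

theorem disjoint_lt_norm : Disjoint (cls '' {x | ‖x.1.2.1‖ < ‖x.1.1‖})
    (cls '' {x | ‖x.1.1‖ < ‖x.1.2.1‖}) := by
  rw [Set.disjoint_left]
  rintro _ ⟨x, hx, rfl⟩ ⟨y, hy, h⟩
  obtain ⟨l, hl, h1, h2, -⟩ := cls_eq.1 h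
  simp only [Set.mem_ofPred_eq, h1, h2, norm_mul'] at hx hy
  exact absurd (lt_of_mul_lt_mul_right hy (norm_nonneg l)) hx.le.not_gt

theorem not_mem_D₂ {p : OP11} (h : p ∉ D₂) : p ∈ cls '' {x | ‖x.1.2.1‖ < ‖x.1.1‖} := by
  obtain ⟨w, rfl⟩ := mem_D₁.1 ((mem_D₁_or_D₂ p).resolve_right h)
  have h0 := not_not.1 (mt cls_mem_D₂.2 h)
  exact ⟨_, by
    dsimp only at h0
    simp [h0, norm_one'], rfl⟩

theorem not_mem_D₁ {p : OP11} (h : p ∉ D₁) : p ∈ cls '' {x | ‖x.1.1‖ < ‖x.1.2.1‖} := by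
  obtain ⟨w, rfl⟩ := mem_D₂.1 ((mem_D₁_or_D₂ p).resolve_left h)
  have h0 := not_not.1 (mt cls_mem_D₁.2 h)
  exact ⟨_, by
    dsimp only at h0
    simp [h0, norm_one'], rfl⟩

theorem separate (e : OpenPartialHomeomorph OP11 OctPair) {p q : OP11} (hp : p ∈ e.source)
    (hq : q ∈ e.source) (h : p ≠ q) :
    ∃ u v : Set OP11, IsOpen u ∧ IsOpen v ∧ p ∈ u ∧ q ∈ v ∧ Disjoint u v := by
  obtain ⟨u, v, hu, hv, hpu, hqv, huv⟩ := t2_separation (e.injOn.ne hp hq h)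
  refine ⟨_, _, e.isOpen_inter_preimage hu, e.isOpen_inter_preimage hv, ⟨hp, hpu⟩, ⟨hq, hqv⟩, ?_⟩
  rw [Set.disjoint_left] at huv ⊢
  exact fun x hx hx' => huv hx.2 hx'.2

instance : T2Space OP11 := ⟨fun p q h => by
  by_cases hp : p ∈ D₁
  · by_cases hq : q ∈ D₁
    · exact separate chart₁ hp hq h
    · by_cases hp' : p ∈ D₂
      · exact separate chart₂ hp' ((mem_D₁_or_D₂ q).resolve_left hq) h
      · exact ⟨_, _, isOpen_lt_norm.1, isOpen_lt_norm.2, not_mem_D₂ hp', not_mem_D₁ hq,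
          disjoint_lt_norm⟩
  · by_cases hq : q ∈ D₂
    · exact separate chart₂ ((mem_D₁_or_D₂ p).resolve_left hp) hq h
    · exact ⟨_, _, isOpen_lt_norm.2, isOpen_lt_norm.1, not_mem_D₁ hp, not_mem_D₂ hq,
        disjoint_lt_norm.symm⟩⟩

instance : SecondCountableTopology OP11 := by
  refine ChartedSpace.secondCountable_of_countable_cover OctPair
    (s := {pt₁ ⟨0, zero_mem_target⟩, pt₂ ⟨0, zero_mem_target⟩}) ?_ (Set.toFinite _).countable
  have h1 : pt₁ ⟨0, zero_mem_target⟩ ∈ D₁ := mem_D₁.2 ⟨_, rfl⟩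
  have h2 : pt₂ ⟨0, zero_mem_target⟩ ∉ D₁ := fun h => cls_mem_D₁.1 h rfl
  have e1 : chartAt OctPair (pt₁ ⟨0, zero_mem_target⟩) = chart₁ := if_pos h1
  have e2 : chartAt OctPair (pt₂ ⟨0, zero_mem_target⟩) = chart₂ := if_neg h2
  rw [Set.biUnion_pair, e1, e2]
  exact Set.eq_univ_of_forall mem_D₁_or_D₂

end OP11

/-- A smooth semi-Riemannian (pseudo-Riemannian) metric: a smooth field of symmetric
nondegenerate bilinear forms on the tangent spaces. -/
structure SemiRiemannianMetric (E : Type*) [NormedAddCommGroup E] [NormedSpace ℝ E]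
    (M : Type*) [TopologicalSpace M] [ChartedSpace E M] [IsManifold 𝓘(ℝ, E) ∞ M] where
  val (p : M) : TangentSpace 𝓘(ℝ, E) p →L[ℝ] TangentSpace 𝓘(ℝ, E) p →L[ℝ] ℝ
  symm (p : M) (X Y : TangentSpace 𝓘(ℝ, E) p) : val p X Y = val p Y X
  nondegenerate (p : M) (X : TangentSpace 𝓘(ℝ, E) p) (h : ∀ Y, val p X Y = 0) : X = 0
  contMDiff : ContMDiff 𝓘(ℝ, E) (𝓘(ℝ, E).prod 𝓘(ℝ, E →L[ℝ] E →L[ℝ] ℝ)) ∞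
    (fun p : M => Bundle.TotalSpace.mk' (E →L[ℝ] E →L[ℝ] ℝ) p (val p))

namespace SemiRiemannianMetric

variable {E : Type*} [NormedAddCommGroup E] [NormedSpace ℝ E]
    {M : Type*} [TopologicalSpace M] [ChartedSpace E M] [IsManifold 𝓘(ℝ, E) ∞ M]

/-- The quadratic form `X ↦ g(X, X)` on the tangent space at `p`. -/
def quadraticForm (g : SemiRiemannianMetric E M) (p : M) :
    QuadraticForm ℝ (TangentSpace 𝓘(ℝ, E) p) :=
  LinearMap.BilinMap.toQuadraticMap
    (LinearMap.mk₂ ℝ (fun X Y => g.val p X Y) (by simp) (by simp) (by simp) (by simp))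

/-- The metric has signature `(k, l)` at every point. -/
def HasSignature (g : SemiRiemannianMetric E M) (k l : ℕ) : Prop :=
  ∀ p, _root_.sigPos (g.quadraticForm p) = k ∧ _root_.sigNeg (g.quadraticForm p) = l

/-- An isometry is a smooth bijection with smooth inverse whose differential preserves the
metric. -/
def IsIsometry (g : SemiRiemannianMetric E M) (F : Equiv.Perm M) : Prop :=
  ContMDiff 𝓘(ℝ, E) 𝓘(ℝ, E) ∞ F ∧ ContMDiff 𝓘(ℝ, E) 𝓘(ℝ, E) ∞ F.symm ∧
    ∀ (p : M) (X Y : TangentSpace 𝓘(ℝ, E) p),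
      g.val (F p) (mfderiv 𝓘(ℝ, E) 𝓘(ℝ, E) F p X) (mfderiv 𝓘(ℝ, E) 𝓘(ℝ, E) F p Y) = g.val p X Y

theorem IsIsometry.one (g : SemiRiemannianMetric E M) : g.IsIsometry 1 := by
  refine ⟨contMDiff_id, contMDiff_id, fun p X Y => ?_⟩
  change g.val p (mfderiv _ _ id p X) (mfderiv _ _ id p Y) = _
  rw [mfderiv_id]; rfl

theorem IsIsometry.mul {g : SemiRiemannianMetric E M} {F G : Equiv.Perm M} (hF : g.IsIsometry F)
    (hG : g.IsIsometry G) : g.IsIsometry (F * G) := by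
  refine ⟨hF.1.comp hG.1, hG.2.1.comp hF.2.1, fun p X Y => ?_⟩
  have h : mfderiv 𝓘(ℝ, E) 𝓘(ℝ, E) (F ∘ G) p = (mfderiv 𝓘(ℝ, E) 𝓘(ℝ, E) F (G p)).comp
      (mfderiv 𝓘(ℝ, E) 𝓘(ℝ, E) G p) :=
    mfderiv_comp p (hF.1.mdifferentiable (by simp) _) (hG.1.mdifferentiable (by simp) _)
  change g.val (F (G p)) (mfderiv 𝓘(ℝ, E) 𝓘(ℝ, E) (F ∘ G) p X)
    (mfderiv 𝓘(ℝ, E) 𝓘(ℝ, E) (F ∘ G) p Y) = _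
  rw [h]
  exact (hF.2.2 (G p) _ _).trans (hG.2.2 p X Y)

theorem IsIsometry.inv {g : SemiRiemannianMetric E M} {F : Equiv.Perm M} (hF : g.IsIsometry F) :
    g.IsIsometry F⁻¹ := by
  refine ⟨hF.2.1, hF.1, fun p X Y => ?_⟩
  have h := mfderiv_comp p (hF.1.mdifferentiable (by simp) (F.symm p))
    (hF.2.1.mdifferentiable (by simp) p)
  have hid : (F ∘ F.symm : M → M) = id := funext F.apply_symm_apply
  rw [hid, mfderiv_id] at h
  have aux : ∀ (q : M) (hq : q = p) (X' Y' : E), X' = X → Y' = Y →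
      g.val q X' Y' = g.val p X Y := by
    rintro q rfl _ _ rfl rfl; rfl
  change g.val (F.symm p) (mfderiv 𝓘(ℝ, E) 𝓘(ℝ, E) F.symm p X)
    (mfderiv 𝓘(ℝ, E) 𝓘(ℝ, E) F.symm p Y) = _
  rw [← hF.2.2]
  refine aux _ (F.apply_symm_apply p) _ _ ?_ ?_
  · exact (DFunLike.congr_fun h X).symm
  · exact (DFunLike.congr_fun h Y).symm

/-- The isometry group. -/
def isometryGroup (g : SemiRiemannianMetric E M) : Subgroup (Equiv.Perm M) where
  carrier := {F | g.IsIsometry F}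
  mul_mem' hF hG := hF.mul hG
  one_mem' := IsIsometry.one g
  inv_mem' hF := hF.inv

end SemiRiemannianMetric

namespace OP11
open Octonion

/-- The expression
`ds² = (|du|² (1 - |v|²) - |dv|² (1 + |u|²) + 2 Re[(u v̄)(dv dū)]) / (1 + |u|² - |v|²)²`
at `w = (u, v)`, evaluated on the tangent vector `ξ = (du, dv)`. -/
def dsSq (w ξ : OctPair) : ℝ :=
  (‖ξ.1‖ ^ 2 * (1 - ‖w.2‖ ^ 2) - ‖ξ.2‖ ^ 2 * (1 + ‖w.1‖ ^ 2)
      + 2 * re ((w.1 * conj w.2) * (ξ.2 * conj ξ.1))) / (1 + ‖w.1‖ ^ 2 - ‖w.2‖ ^ 2) ^ 2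

/-- `g` is given by the expression `dsSq` in both charts `U₁/∼` and `U₂/∼`. -/
def IsGivenByDsSq (g : SemiRiemannianMetric OctPair OP11) : Prop :=
  (∀ p ∈ D₁, ∀ X : TangentSpace 𝓘(ℝ, OctPair) p,
    g.val p X X = dsSq (φ₁ p) (mfderiv 𝓘(ℝ, OctPair) 𝓘(ℝ, OctPair) φ₁ p X)) ∧
  (∀ p ∈ D₂, ∀ X : TangentSpace 𝓘(ℝ, OctPair) p,
    g.val p X X = dsSq (φ₂ p) (mfderiv 𝓘(ℝ, OctPair) 𝓘(ℝ, OctPair) φ₂ p X))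

/-- The "indefinite reflection" `(u, v) ↦ (-ru + λv, -λ̄u + rv)`, used for `r² - |λ|² = 1`. -/
def indefRefl (r : ℝ) (l : Octonion) (w : OctPair) : OctPair :=
  (-(r • w.1) + l * w.2, -(conj l * w.1) + r • w.2)

/-- The "Euclidean reflection" `(x, y) ↦ (rx + λy, λ̄x - ry)`, used for `r² + |λ|² = 1`. -/
def euclRefl (r : ℝ) (l : Octonion) (w : OctPair) : OctPair :=
  (r • w.1 + l * w.2, conj l * w.1 - r • w.2)

/-- `F` extends the map of the coordinate patch `D` that reads `f` in the coordinates `φ`. -/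
def Extends (F : Equiv.Perm OP11) (D : Set OP11) (φ : OP11 → OctPair) (f : OctPair → OctPair) :
    Prop :=
  ∀ p ∈ D, F p ∈ D ∧ φ (F p) = f (φ p)

/-- `F` extends an indefinite reflection of `U₁/∼` or `U₂/∼` or a Euclidean reflection of
`U₃/∼`. -/
def ExtendsReflection (F : Equiv.Perm OP11) : Prop :=
  (∃ (r : ℝ) (l : Octonion), r ^ 2 - ‖l‖ ^ 2 = 1 ∧
    (Extends F D₁ φ₁ (indefRefl r l) ∨ Extends F D₂ φ₂ (indefRefl r l))) ∨
  (∃ (r : ℝ) (l : Octonion), r ^ 2 + ‖l‖ ^ 2 = 1 ∧ Extends F D₃ φ₃ (euclRefl r l))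

/-- The map of the patch `D` that reads `f` in the coordinates `φ` extends to one and only one
isometry of `OP11`, and this isometry is an involution. -/
def ExtendsToUniqueInvolutiveIsometry (g : SemiRiemannianMetric OctPair OP11) (D : Set OP11)
    (φ : OP11 → OctPair) (f : OctPair → OctPair) : Prop :=
  ∃ F : Equiv.Perm OP11, g.IsIsometry F ∧ Extends F D φ f ∧ F * F = 1 ∧
    ∀ F' : Equiv.Perm OP11, g.IsIsometry F' → Extends F' D φ f → F' = F

end OP11

end

/-!
A point of the plane is an octonionic line on which the form `|a|² + |b|² - |c|²` is positive, and
it is determined by the projection onto that line, a Hermitian `3 × 3` matrix. This embeds the plane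
as a closed subset of a real vector space, and `ds²` is half the pullback of the trace form. It is
nondegenerate of signature `(8, 8)`: in each chart it is positive on the graph of the linear map
`du ↦ dv = (1 + |u|²)⁻¹ (v ū) du` and negative on the directions `du = 0`.

A reflection acts on the Hermitian matrices by a linear involution that preserves the trace and the
trace form. Since the image of the plane is closed, such an involution preserves it as soon as it
does so over a dense patch, and it then induces an isometry of the whole plane. Two reflections
move any point to `[1, 0, 0]`: a Euclidean one annihilates the second coordinate, and an indefinite
one then annihilates the third.
-/

noncomputable section

open scoped InnerProductSpace

section signature

variable {V₁ V₂ W : Type*} [AddCommGroup V₁] [Module ℝ V₁] [AddCommGroup V₂] [Module ℝ V₂]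
  [AddCommGroup W] [Module ℝ W]

theorem finrank_le_sigPos_of_pos [FiniteDimensional ℝ W] {Q : QuadraticForm ℝ W}
    (f : V₁ →ₗ[ℝ] W) (hf : ∀ x, x ≠ 0 → 0 < Q (f x)) :
    Module.finrank ℝ V₁ ≤ _root_.sigPos Q := by
  have hinj : Function.Injective f := (injective_iff_map_eq_zero f).2 fun x hx => by
    by_contra hx0
    simpa only [hx, QuadraticMap.map_zero, lt_irrefl] using hf x hx0
  rw [← LinearMap.finrank_range_of_inj hinj]
  refine le_sigPos_of_posDef Q ?_
  rintro ⟨_, x, rfl⟩ hx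
  exact hf x (by rintro rfl; exact hx (Subtype.ext (map_zero f)))

theorem sigPos_sigNeg_radical_of_pos_of_neg [FiniteDimensional ℝ W] {Q : QuadraticForm ℝ W}
    (f₁ : V₁ →ₗ[ℝ] W) (h₁ : ∀ x, x ≠ 0 → 0 < Q (f₁ x))
    (f₂ : V₂ →ₗ[ℝ] W) (h₂ : ∀ y, y ≠ 0 → Q (f₂ y) < 0)
    (hdim : Module.finrank ℝ W ≤ Module.finrank ℝ V₁ + Module.finrank ℝ V₂) :
    _root_.sigPos Q = Module.finrank ℝ V₁ ∧ _root_.sigNeg Q = Module.finrank ℝ V₂ ∧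
      Q.radical = ⊥ := by
  have hpos := finrank_le_sigPos_of_pos f₁ h₁
  have hneg : Module.finrank ℝ V₂ ≤ _root_.sigNeg Q :=
    finrank_le_sigPos_of_pos f₂ fun y hy => neg_pos.2 (h₂ y hy)
  have hsum := QuadraticForm.sigPos_add_sigNeg_add_radical (Q := Q)
  exact ⟨by omega, by omega, Submodule.finrank_eq_zero.1 (by omega)⟩

end signature

section smoothness

variable {E : Type*} [NormedAddCommGroup E] [NormedSpace ℝ E]
  {M : Type*} [TopologicalSpace M] [ChartedSpace E M] [IsManifold 𝓘(ℝ, E) ∞ M]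

set_option maxSynthPendingDepth 3 in
theorem contMDiffAt_bilinearForm_of_chartAt
    (val : ∀ p : M, TangentSpace 𝓘(ℝ, E) p →L[ℝ] TangentSpace 𝓘(ℝ, E) p →L[ℝ] ℝ) (p₀ : M)
    {G : E → E →L[ℝ] E →L[ℝ] ℝ} (hG : ContDiffAt ℝ ∞ G (chartAt E p₀ p₀))
    (hval : ∀ p ∈ (chartAt E p₀).source, ∀ X Y : TangentSpace 𝓘(ℝ, E) p,
      val p X Y = G (chartAt E p₀ p) (mfderiv 𝓘(ℝ, E) 𝓘(ℝ, E) (chartAt E p₀) p X)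
        (mfderiv 𝓘(ℝ, E) 𝓘(ℝ, E) (chartAt E p₀) p Y)) :
    ContMDiffAt 𝓘(ℝ, E) (𝓘(ℝ, E).prod 𝓘(ℝ, E →L[ℝ] E →L[ℝ] ℝ)) ∞
      (fun p : M => Bundle.TotalSpace.mk' (E →L[ℝ] E →L[ℝ] ℝ) p (val p)) p₀ := by
  have hGe : ContMDiffAt 𝓘(ℝ, E) 𝓘(ℝ, E →L[ℝ] E →L[ℝ] ℝ) ∞ (G ∘ chartAt E p₀) p₀ :=
    hG.contMDiffAt.comp p₀ (contMDiffAt_of_mem_maximalAtlas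
      (IsManifold.chart_mem_maximalAtlas p₀) (mem_chart_source E p₀))
  refine contMDiffAt_hom_bundle _ |>.2 ⟨contMDiffAt_id, hGe.congr_of_eventuallyEq ?_⟩
  filter_upwards [(chartAt E p₀).open_source.mem_nhds (mem_chart_source E p₀)] with p hp
  have hbase : p ∈ (trivializationAt E (TangentSpace 𝓘(ℝ, E)) p₀).baseSet := hp
  have hderiv := TangentBundle.continuousLinearMapAt_trivializationAt (I := 𝓘(ℝ, E)) hp
  set T := trivializationAt E (TangentSpace 𝓘(ℝ, E)) p₀
  have hsymm (Z : E) : mfderiv 𝓘(ℝ, E) 𝓘(ℝ, E) (chartAt E p₀) p (T.symm p Z) = Z := by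
    have hright := T.continuousLinearMapAt_symmL (R := ℝ) hbase Z
    rwa [hderiv, T.symmL_apply (R := ℝ) hbase] at hright
  ext X Y
  refine (inCoordinates_apply_eq₂ (E₃ := Bundle.Trivial M ℝ) hbase hbase (Set.mem_univ p)).trans ?_
  have hcoord : val p (T.symm p X) (T.symm p Y) = G (chartAt E p₀ p) X Y :=
    (hval p hp _ _).trans
      (congrArg₂ (fun X Y : E => G (chartAt E p₀ p) X Y) (hsymm X) (hsymm Y))
  simpa using hcoord

end smoothness

namespace SemiRiemannianMetric

variable {E : Type*} [NormedAddCommGroup E] [NormedSpace ℝ E]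
  {M : Type*} [TopologicalSpace M] [ChartedSpace E M] [IsManifold 𝓘(ℝ, E) ∞ M]

theorem ext_of_val_self {g g' : SemiRiemannianMetric E M}
    (h : ∀ (p : M) (X : TangentSpace 𝓘(ℝ, E) p), g.val p X X = g'.val p X X) : g = g' := by
  have hval : g.val = g'.val := by
    funext p
    ext X Y
    have hadd := h p (X + Y)
    simp only [map_add, add_apply, h p X, h p Y, g.symm p Y X, g'.symm p Y X] at hadd
    linarith
  cases g
  cases g'
  congr

end SemiRiemannianMetric

section density

variable {X Y : Type*} [TopologicalSpace X] [TopologicalSpace Y]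

theorem source_subset_closure_of_dense {S : Set X} {T : Set Y} (e : OpenPartialHomeomorph X Y)
    (hT : Dense T) (hTS : ∀ y ∈ e.target, y ∈ T → e.symm y ∈ S) : e.source ⊆ closure S := by
  intro x hx
  have hclosure : e x ∈ closure (e.target ∩ T) :=
    hT.open_subset_closure_inter e.open_target (e.map_source hx)
  rw [← e.left_inv hx]
  exact (e.continuousAt_symm (e.map_source hx)).continuousWithinAt.mem_closure hclosure
    fun y hy => hTS y hy.1 hy.2

end density

theorem exists_sq_mul_eq_one {a : ℝ} (ha : 0 < a) : ∃ r : ℝ, r ^ 2 * a = 1 :=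
  ⟨(√a)⁻¹, by rw [inv_pow, Real.sq_sqrt ha.le, inv_mul_cancel₀ ha.ne']⟩

/-! ### Octonion algebra -/

namespace Octonion

instance : NonAssocRing Octonion where
  left_distrib a b c := by apply ext' <;> ext <;> simp <;> ring
  right_distrib a b c := by apply ext' <;> ext <;> simp <;> ring
  zero_mul := zero_mul'
  mul_zero := mul_zero'
  one_mul := one_mul'
  mul_one := mul_one'

instance : IsScalarTower ℝ Octonion Octonion := ⟨smul_mul'⟩
instance : SMulCommClass ℝ Octonion Octonion := ⟨fun r a b => (mul_smul' r a b).symm⟩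

theorem conj_add (a b : Octonion) : (a + b).conj = a.conj + b.conj := by
  apply ext' <;> ext <;> simp <;> ring

theorem conj_smul (r : ℝ) (a : Octonion) : (r • a).conj = r • a.conj := by
  apply ext' <;> ext <;> simp

theorem conj_neg (a : Octonion) : (-a).conj = -a.conj := by
  simpa only [neg_smul, one_smul] using conj_smul (-1) a

theorem conj_one : (1 : Octonion).conj = 1 := by
  apply ext' <;> ext <;> simp

theorem continuous_conj : Continuous conj := (contDiff_conj (n := 0)).continuous

theorem conj_inv (a : Octonion) : (a⁻¹).conj = (‖a‖ ^ 2)⁻¹ • a := by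
  rw [inv_def, conj_smul, conj_conj]

theorem mul_conj_mul_left (a b : Octonion) : a * (a.conj * b) = ‖a‖ ^ 2 • b := by
  simpa only [conj_conj, norm_conj] using conj_mul_mul b a.conj

theorem inner_eq (a b : Octonion) : ⟪a, b⟫_ℝ =
    a.fst.re * b.fst.re + a.fst.imI * b.fst.imI + a.fst.imJ * b.fst.imJ + a.fst.imK * b.fst.imK +
    (a.snd.re * b.snd.re + a.snd.imI * b.snd.imI + a.snd.imJ * b.snd.imJ +
      a.snd.imK * b.snd.imK) := by
  have h := norm_add_sq_real a b
  simp only [norm_sq_eq, fst_add, snd_add, Quaternion.re_add, Quaternion.imI_add,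
    Quaternion.imJ_add, Quaternion.imK_add] at h
  linarith

theorem inner_mul_eq_inner_conj_mul (a b c : Octonion) : ⟪a * b, c⟫_ℝ = ⟪b, a.conj * c⟫_ℝ := by
  simp [inner_eq]; ring

theorem inner_mul_eq_inner_mul_conj (a b c : Octonion) : ⟪a * b, c⟫_ℝ = ⟪a, c * b.conj⟫_ℝ := by
  simp [inner_eq]; ring

theorem inner_conj_conj (a b : Octonion) : ⟪a.conj, b.conj⟫_ℝ = ⟪a, b⟫_ℝ := by
  simp [inner_eq]

theorem re_mul_eq_inner (a b : Octonion) : (a * b).re = ⟪a, b.conj⟫_ℝ := by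
  simp [inner_eq, re]; ring

theorem inner_mul_mul_left (a b c : Octonion) : ⟪a * b, a * c⟫_ℝ = ‖a‖ ^ 2 * ⟪b, c⟫_ℝ := by
  rw [inner_mul_eq_inner_conj_mul, conj_mul_mul, real_inner_smul_right]

theorem inner_mul_mul_right (a b c : Octonion) : ⟪a * c, b * c⟫_ℝ = ‖c‖ ^ 2 * ⟪a, b⟫_ℝ := by
  rw [inner_mul_eq_inner_mul_conj, mul_mul_conj, real_inner_smul_right]

theorem inner_mul_mul_add (a b c d : Octonion) :
    ⟪a * c, b * d⟫_ℝ + ⟪a * d, b * c⟫_ℝ = 2 * (⟪a, b⟫_ℝ * ⟪c, d⟫_ℝ) := by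
  have h := inner_mul_mul_right a b (c + d)
  rw [norm_add_sq_real, mul_add, mul_add, inner_add_left, inner_add_right, inner_add_right,
    inner_mul_mul_right, inner_mul_mul_right] at h
  linarith

theorem inner_right_mul (a b c : Octonion) : ⟪b, a * c⟫_ℝ = ⟪a, b * c.conj⟫_ℝ := by
  rw [real_inner_comm, inner_mul_eq_inner_mul_conj]

theorem inner_conj_mul (a b c : Octonion) : ⟪a.conj * b, c⟫_ℝ = ⟪a, b * c.conj⟫_ℝ := by
  rw [inner_mul_eq_inner_conj_mul, conj_conj, inner_right_mul]

/-- A form of the Moufang identity `(l v)(ū l) = l (v ū) l`. -/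
theorem mul_mul_conj_mul (l u v : Octonion) :
    (l * v) * (u.conj * l) = (2 * ⟪l, u * v.conj⟫_ℝ) • l - ‖l‖ ^ 2 • (u * v.conj) := by
  refine ext_inner_right ℝ fun w => ?_
  have polarized := inner_mul_mul_add l w v (l.conj * u)
  rw [mul_conj_mul_left, real_inner_smul_left, inner_right_mul w u v,
    real_inner_comm _ v, inner_conj_mul] at polarized
  rw [inner_mul_eq_inner_mul_conj, conj_mul, conj_conj, inner_sub_left, real_inner_smul_left,
    real_inner_smul_left, real_inner_comm w (u * v.conj)]
  linarith

section reflection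

variable (r s : ℝ) (l x y : Octonion)

theorem norm_sq_smul_add_mul :
    ‖r • x + l * y‖ ^ 2 = r ^ 2 * ‖x‖ ^ 2 + ‖l‖ ^ 2 * ‖y‖ ^ 2 + 2 * r * ⟪l, x * y.conj⟫_ℝ := by
  rw [norm_add_sq_real, norm_smul, mul_pow, norm_sq_mul, real_inner_smul_left, inner_right_mul,
    Real.norm_eq_abs, sq_abs]
  ring

theorem norm_sq_conj_mul_add_smul :
    ‖l.conj * x + s • y‖ ^ 2 =
      ‖l‖ ^ 2 * ‖x‖ ^ 2 + s ^ 2 * ‖y‖ ^ 2 + 2 * s * ⟪l, x * y.conj⟫_ℝ := by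
  rw [norm_add_sq_real, norm_smul, mul_pow, norm_sq_mul, norm_conj, real_inner_smul_right,
    inner_conj_mul, Real.norm_eq_abs, sq_abs]
  ring

theorem smul_add_mul_mul_conj :
    (r • x + l * y) * (l.conj * x + s • y).conj =
      (r * ‖x‖ ^ 2 + s * ‖y‖ ^ 2 + 2 * ⟪l, x * y.conj⟫_ℝ) • l
        + (r * s - ‖l‖ ^ 2) • (x * y.conj) := by
  rw [conj_add, conj_mul, conj_conj, conj_smul, add_mul, mul_add, mul_add, smul_mul_assoc,
    smul_mul_smul_comm, mul_conj_mul_left, mul_mul_conj_mul, mul_smul_comm, mul_mul_conj]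
  module

end reflection

theorem finrank_eq : Module.finrank ℝ Octonion = 8 := by
  have e : Octonion ≃ₗ[ℝ] ℍ[ℝ] × ℍ[ℝ] := WithLp.linearEquiv 2 ℝ (ℍ[ℝ] × ℍ[ℝ])
  rw [e.finrank_eq, Module.finrank_prod, Quaternion.finrank_eq_four]

instance : Nontrivial Octonion := ⟨1, 0, one_ne_zero'⟩

theorem dense_fst_ne_zero : Dense {w : OctPair | w.1 ≠ 0} :=
  (dense_compl_singleton (0 : Octonion)).preimage isOpenMap_fst

theorem dense_snd_ne_zero : Dense {w : OctPair | w.2 ≠ 0} :=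
  (dense_compl_singleton (0 : Octonion)).preimage isOpenMap_snd

theorem norm_sq_smul_conj (r : ℝ) (a : Octonion) : ‖r • conj a‖ ^ 2 = r ^ 2 * ‖a‖ ^ 2 := by
  rw [norm_smul, mul_pow, Real.norm_eq_abs, sq_abs, norm_conj]

end Octonion

namespace OP11

open Octonion

/-! ### Hermitian matrices and their reflections -/

/-- The space of octonionic `3 × 3` matrices that are Hermitian with respect to the form
`|a|² + |b|² - |c|²`, encoded by the diagonal entries at the places `aā`, `bb̄`, `cc̄` followed by
the entries at the places `ab̄`, `bc̄`, `ac̄`. -/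
abbrev Herm : Type := ℝ × ℝ × ℝ × Octonion × Octonion × Octonion

/-- The entry of a Hermitian matrix at the place `aā`. -/
def diag₁ : Herm →L[ℝ] ℝ := .fst ℝ _ _
/-- The entry of a Hermitian matrix at the place `bb̄`. -/
def diag₂ : Herm →L[ℝ] ℝ := .fst ℝ _ _ ∘L .snd ℝ _ _
/-- The entry of a Hermitian matrix at the place `cc̄`. -/
def diag₃ : Herm →L[ℝ] ℝ := .fst ℝ _ _ ∘L .snd ℝ _ _ ∘L .snd ℝ _ _
/-- The entry of a Hermitian matrix at the place `ab̄`. -/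
def entry₁₂ : Herm →L[ℝ] Octonion := .fst ℝ _ _ ∘L .snd ℝ _ _ ∘L .snd ℝ _ _ ∘L .snd ℝ _ _
/-- The entry of a Hermitian matrix at the place `bc̄`. -/
def entry₂₃ : Herm →L[ℝ] Octonion :=
  .fst ℝ _ _ ∘L .snd ℝ _ _ ∘L .snd ℝ _ _ ∘L .snd ℝ _ _ ∘L .snd ℝ _ _
/-- The entry of a Hermitian matrix at the place `ac̄`. -/
def entry₁₃ : Herm →L[ℝ] Octonion :=
  .snd ℝ _ _ ∘L .snd ℝ _ _ ∘L .snd ℝ _ _ ∘L .snd ℝ _ _ ∘L .snd ℝ _ _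

section entries

variable (α β γ : ℝ) (x y z : Octonion)

@[simp] theorem diag₁_mk : diag₁ (α, β, γ, x, y, z) = α := rfl
@[simp] theorem diag₂_mk : diag₂ (α, β, γ, x, y, z) = β := rfl
@[simp] theorem diag₃_mk : diag₃ (α, β, γ, x, y, z) = γ := rfl
@[simp] theorem entry₁₂_mk : entry₁₂ (α, β, γ, x, y, z) = x := rfl
@[simp] theorem entry₂₃_mk : entry₂₃ (α, β, γ, x, y, z) = y := rfl
@[simp] theorem entry₁₃_mk : entry₁₃ (α, β, γ, x, y, z) = z := rfl

end entries

/-- The trace with respect to the form `|a|² + |b|² - |c|²`. -/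
def trace : Herm →L[ℝ] ℝ := diag₁ + diag₂ - diag₃

theorem trace_apply (X : Herm) : trace X = diag₁ X + diag₂ X - diag₃ X := rfl

/-- The trace form `(X, Y) ↦ tr (XY)` with respect to the form `|a|² + |b|² - |c|²`. -/
def traceForm : Herm →L[ℝ] Herm →L[ℝ] ℝ :=
  (LinearMap.mk₂ ℝ (fun X Y : Herm =>
    diag₁ X * diag₁ Y + diag₂ X * diag₂ Y + diag₃ X * diag₃ Y
      + 2 * ⟪entry₁₂ X, entry₁₂ Y⟫_ℝ - 2 * ⟪entry₂₃ X, entry₂₃ Y⟫_ℝ - 2 * ⟪entry₁₃ X, entry₁₃ Y⟫_ℝ)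
    (fun X X' Y => by simp only [map_add, inner_add_left]; ring)
    (fun r X Y => by simp only [map_smul, real_inner_smul_left, smul_eq_mul]; ring)
    (fun X Y Y' => by simp only [map_add, inner_add_right]; ring)
    (fun r X Y => by
      simp only [map_smul, real_inner_smul_right, smul_eq_mul]; ring)).toContinuousBilinearMap

theorem traceForm_apply (X Y : Herm) : traceForm X Y =
    diag₁ X * diag₁ Y + diag₂ X * diag₂ Y + diag₃ X * diag₃ Y
      + 2 * ⟪entry₁₂ X, entry₁₂ Y⟫_ℝ - 2 * ⟪entry₂₃ X, entry₂₃ Y⟫_ℝ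
      - 2 * ⟪entry₁₃ X, entry₁₃ Y⟫_ℝ := rfl

theorem traceForm_comm (X Y : Herm) : traceForm X Y = traceForm Y X := by
  simp only [traceForm_apply, real_inner_comm (entry₁₂ X), real_inner_comm (entry₂₃ X),
    real_inner_comm (entry₁₃ X)]
  ring

theorem traceForm_self (X : Herm) : traceForm X X =
    diag₁ X ^ 2 + diag₂ X ^ 2 + diag₃ X ^ 2
      + 2 * ‖entry₁₂ X‖ ^ 2 - 2 * ‖entry₂₃ X‖ ^ 2 - 2 * ‖entry₁₃ X‖ ^ 2 := by
  simp only [traceForm_apply, real_inner_self_eq_norm_sq]; ring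

/-- A linear involution of the Hermitian matrices that preserves the trace and the trace form. -/
structure IsReflection (L : Herm →ₗ[ℝ] Herm) : Prop where
  involutive (X : Herm) : L (L X) = X
  map_trace (X : Herm) : trace (L X) = trace X
  map_traceForm_self (X : Herm) : traceForm (L X) (L X) = traceForm X X

namespace IsReflection

variable {K L : Herm →ₗ[ℝ] Herm}

theorem id : IsReflection .id where
  involutive _ := rfl
  map_trace _ := rfl
  map_traceForm_self _ := rfl

theorem conjugate (hK : IsReflection K) (hL : IsReflection L) : IsReflection (K ∘ₗ L ∘ₗ K) where
  involutive X := by simp only [LinearMap.comp_apply, hK.involutive, hL.involutive]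
  map_trace X := by simp only [LinearMap.comp_apply, hK.map_trace, hL.map_trace]
  map_traceForm_self X := by
    simp only [LinearMap.comp_apply, hK.map_traceForm_self, hL.map_traceForm_self]

theorem map_traceForm (hL : IsReflection L) (X Y : Herm) :
    traceForm (L X) (L Y) = traceForm X Y := by
  have h := hL.map_traceForm_self (X + Y)
  simp only [map_add, add_apply, hL.map_traceForm_self, traceForm_comm Y X,
    traceForm_comm (L Y) (L X)] at h
  linarith

end IsReflection

/-- The linear map induced by `(a, b, c) ↦ (b, a, c)`. -/
def swapHerm : Herm →ₗ[ℝ] Herm where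
  toFun X := (diag₂ X, diag₁ X, diag₃ X, conj (entry₁₂ X), entry₁₃ X, entry₂₃ X)
  map_add' X Y := by simp [conj_add]
  map_smul' r X := by simp [conj_smul]

theorem swapHerm_apply (X : Herm) : swapHerm X =
    (diag₂ X, diag₁ X, diag₃ X, conj (entry₁₂ X), entry₁₃ X, entry₂₃ X) := rfl

theorem isReflection_swapHerm : IsReflection swapHerm where
  involutive X := by simp only [swapHerm_apply, diag₁_mk, diag₂_mk, diag₃_mk, entry₁₂_mk,
    entry₂₃_mk, entry₁₃_mk, conj_conj]; rfl
  map_trace X := by simp [swapHerm_apply, trace_apply]; ring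
  map_traceForm_self X := by simp [swapHerm_apply, traceForm_self, norm_conj]; ring

/-- The linear map induced by `(a, b, c) ↦ (a, -rb + λc, -λ̄b + rc)`. -/
def indefHerm (r : ℝ) (l : Octonion) : Herm →ₗ[ℝ] Herm where
  toFun X := (diag₁ X,
    r ^ 2 * diag₂ X + ‖l‖ ^ 2 * diag₃ X - 2 * r * ⟪l, entry₂₃ X⟫_ℝ,
    ‖l‖ ^ 2 * diag₂ X + r ^ 2 * diag₃ X - 2 * r * ⟪l, entry₂₃ X⟫_ℝ,
    -(r • entry₁₂ X) + entry₁₃ X * conj l,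
    (r * (diag₂ X + diag₃ X) - 2 * ⟪l, entry₂₃ X⟫_ℝ) • l - entry₂₃ X,
    -(entry₁₂ X * l) + r • entry₁₃ X)
  map_add' X Y := by
    simp only [map_add, inner_add_right, add_mul, Prod.mk_add_mk, Prod.mk.injEq, true_and]
    refine ⟨by ring, by ring, by module, by module, by module⟩
  map_smul' s X := by
    simp only [map_smul, real_inner_smul_right, smul_mul_assoc, Prod.smul_mk, Prod.mk.injEq,
      smul_eq_mul, RingHom.id_apply, true_and]
    refine ⟨by ring, by ring, by module, by module, by module⟩

theorem isReflection_indefHerm {r : ℝ} {l : Octonion} (h : r ^ 2 - ‖l‖ ^ 2 = 1) :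
    IsReflection (indefHerm r l) where
  involutive X := by
    obtain ⟨α, β, γ, x, y, z⟩ := X
    have hl : ‖l‖ ^ 2 = r ^ 2 - 1 := by linarith
    simp only [indefHerm, LinearMap.coe_mk, AddHom.coe_mk, diag₁_mk, diag₂_mk, diag₃_mk, entry₁₂_mk,
      entry₂₃_mk, entry₁₃_mk, inner_sub_right, real_inner_smul_right, real_inner_self_eq_norm_sq,
      add_mul, neg_mul, smul_mul_assoc, mul_mul_conj, mul_conj_mul, Prod.mk.injEq, true_and, hl]
    refine ⟨by ring, by ring, ?_, ?_, ?_⟩ <;> module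
  map_trace X := by
    simp only [indefHerm, LinearMap.coe_mk, AddHom.coe_mk, trace_apply, diag₁_mk, diag₂_mk,
      diag₃_mk]
    linear_combination (diag₂ X - diag₃ X) * h
  map_traceForm_self X := by
    obtain ⟨α, β, γ, x, y, z⟩ := X
    have hl : ‖l‖ ^ 2 = r ^ 2 - 1 := by linarith
    simp only [indefHerm, LinearMap.coe_mk, AddHom.coe_mk, traceForm_self, diag₁_mk, diag₂_mk,
      diag₃_mk, entry₁₂_mk, entry₂₃_mk, entry₁₃_mk, norm_add_sq_real, norm_sub_sq_real, norm_neg,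
      inner_neg_left, real_inner_smul_left, real_inner_smul_right, norm_smul, mul_pow,
      norm_sq_mul, norm_conj, Real.norm_eq_abs, sq_abs, inner_mul_eq_inner_mul_conj x l z, hl]
    ring

/-- The linear map induced by `(a, b, c) ↦ (ra + λb, λ̄a - rb, c)`. -/
def euclHerm (r : ℝ) (l : Octonion) : Herm →ₗ[ℝ] Herm where
  toFun X := (r ^ 2 * diag₁ X + ‖l‖ ^ 2 * diag₂ X + 2 * r * ⟪l, entry₁₂ X⟫_ℝ,
    ‖l‖ ^ 2 * diag₁ X + r ^ 2 * diag₂ X - 2 * r * ⟪l, entry₁₂ X⟫_ℝ,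
    diag₃ X,
    (r * (diag₁ X - diag₂ X) + 2 * ⟪l, entry₁₂ X⟫_ℝ) • l - entry₁₂ X,
    conj l * entry₁₃ X - r • entry₂₃ X,
    r • entry₁₃ X + l * entry₂₃ X)
  map_add' X Y := by
    simp only [map_add, inner_add_right, mul_add, Prod.mk_add_mk, Prod.mk.injEq, true_and]
    refine ⟨by ring, by ring, by module, by module, by module⟩
  map_smul' s X := by
    simp only [map_smul, real_inner_smul_right, mul_smul_comm, Prod.smul_mk, Prod.mk.injEq,
      smul_eq_mul, RingHom.id_apply, true_and]
    refine ⟨by ring, by ring, by module, by module, by module⟩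

theorem isReflection_euclHerm {r : ℝ} {l : Octonion} (h : r ^ 2 + ‖l‖ ^ 2 = 1) :
    IsReflection (euclHerm r l) where
  involutive X := by
    obtain ⟨α, β, γ, x, y, z⟩ := X
    have hl : ‖l‖ ^ 2 = 1 - r ^ 2 := by linarith
    simp only [euclHerm, LinearMap.coe_mk, AddHom.coe_mk, diag₁_mk, diag₂_mk, diag₃_mk, entry₁₂_mk,
      entry₂₃_mk, entry₁₃_mk, inner_sub_right, real_inner_smul_right, real_inner_self_eq_norm_sq,
      mul_add, mul_sub, mul_smul_comm, conj_mul_mul, mul_conj_mul_left, Prod.mk.injEq, true_and, hl]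
    refine ⟨by ring, by ring, ?_, ?_, ?_⟩ <;> module
  map_trace X := by
    simp only [euclHerm, LinearMap.coe_mk, AddHom.coe_mk, trace_apply, diag₁_mk, diag₂_mk,
      diag₃_mk]
    linear_combination (diag₁ X + diag₂ X) * h
  map_traceForm_self X := by
    obtain ⟨α, β, γ, x, y, z⟩ := X
    have hl : ‖l‖ ^ 2 = 1 - r ^ 2 := by linarith
    have h_inner : ⟪z, l * y⟫_ℝ = ⟪conj l * z, y⟫_ℝ := by rw [inner_right_mul, inner_conj_mul]
    simp only [euclHerm, LinearMap.coe_mk, AddHom.coe_mk, traceForm_self, diag₁_mk, diag₂_mk,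
      diag₃_mk, entry₁₂_mk, entry₂₃_mk, entry₁₃_mk, norm_add_sq_real, norm_sub_sq_real,
      real_inner_smul_left, real_inner_smul_right, norm_smul, mul_pow, norm_sq_mul, norm_conj,
      Real.norm_eq_abs, sq_abs, hl, h_inner]
    ring

/-- The Hermitian matrix `v v*` of a vector `v = (a, b, c)`. -/
def outer (a b c : Octonion) : Herm :=
  (‖a‖ ^ 2, ‖b‖ ^ 2, ‖c‖ ^ 2, a * conj b, b * conj c, a * conj c)

theorem trace_outer (a b c : Octonion) : trace (outer a b c) = ‖a‖ ^ 2 + ‖b‖ ^ 2 - ‖c‖ ^ 2 := rfl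

theorem trace_outer_one (u v : Octonion) : trace (outer 1 u v) = 1 + ‖u‖ ^ 2 - ‖v‖ ^ 2 := by
  rw [trace_outer, norm_one', one_pow]

theorem swapHerm_outer (a b c : Octonion) : swapHerm (outer a b c) = outer b a c := by
  simp [swapHerm_apply, outer, conj_mul, conj_conj]

theorem indefHerm_outer {r : ℝ} {l : Octonion} (h : r ^ 2 - ‖l‖ ^ 2 = 1) (w : OctPair) :
    indefHerm r l (outer 1 w.1 w.2) = outer 1 (indefRefl r l w).1 (indefRefl r l w).2 := by
  obtain ⟨u, v⟩ := w
  have refl_eq : indefRefl r l (u, v) = ((-r) • u + l * v, -(conj l * u + (-r) • v)) := by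
    simp only [indefRefl, neg_smul, neg_add, neg_neg]
  simp only [refl_eq, indefHerm, outer, LinearMap.coe_mk, AddHom.coe_mk, diag₁_mk, diag₂_mk,
    diag₃_mk, entry₁₂_mk, entry₂₃_mk, entry₁₃_mk, one_mul, conj_neg, mul_neg, norm_neg,
    norm_sq_smul_add_mul, norm_sq_conj_mul_add_smul, smul_add_mul_mul_conj, Prod.mk.injEq, true_and]
  refine ⟨by ring, by ring, ?_, ?_, ?_⟩
  · rw [conj_add, conj_smul, Octonion.conj_mul, neg_smul]
  · rw [show -(-r * r) - ‖l‖ ^ 2 = 1 by linarith]; module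
  · rw [conj_add, conj_smul, Octonion.conj_mul, conj_conj]; module

theorem euclHerm_outer {r : ℝ} {l : Octonion} (h : r ^ 2 + ‖l‖ ^ 2 = 1) (w : OctPair) :
    euclHerm r l (outer w.1 w.2 1) = outer (euclRefl r l w).1 (euclRefl r l w).2 1 := by
  obtain ⟨x, y⟩ := w
  have h' : r * -r - ‖l‖ ^ 2 = -1 := by linarith
  have refl_eq : euclRefl r l (x, y) = (r • x + l * y, conj l * x + (-r) • y) := by
    simp only [euclRefl, neg_smul, sub_eq_add_neg]
  simp only [refl_eq, euclHerm, outer, LinearMap.coe_mk, AddHom.coe_mk, diag₁_mk, diag₂_mk,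
    diag₃_mk, entry₁₂_mk, entry₂₃_mk, entry₁₃_mk, mul_one, conj_one, norm_sq_smul_add_mul,
    norm_sq_conj_mul_add_smul, smul_add_mul_mul_conj, Prod.mk.injEq, h', true_and, and_true]
  refine ⟨by ring, by module, by module⟩

theorem outer_inv_one {u v : Octonion} (hu : u ≠ 0) :
    outer u⁻¹ 1 (v * u⁻¹) = (‖u‖ ^ 2)⁻¹ • outer 1 u v := by
  have hu' := norm_sq_ne hu
  simp only [outer, Prod.smul_mk, Prod.mk.injEq, norm_mul', norm_inv', norm_one', conj_one,
    mul_one, one_mul, Octonion.conj_mul, conj_inv, smul_eq_mul, mul_pow,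
    inv_pow, one_pow, smul_mul_assoc, inv_mul_cancel₀ hu', true_and]
  refine ⟨mul_comm _ _, inv_def u, ?_⟩
  rw [inv_def, smul_mul_assoc, mul_smul_comm, conj_mul_mul, inv_smul_smul₀ hu']

/-- The Hermitian projection `v v* / (v* v)` onto the line of `v = (a, b, c)`. -/
def lineProj (a b c : Octonion) : Herm := (trace (outer a b c))⁻¹ • outer a b c

theorem lineProj_eq_of_outer_eq_smul {X : Herm} {a b c : Octonion} {s : ℝ} (hs : s ≠ 0)
    (h : outer a b c = s • X) : lineProj a b c = (trace X)⁻¹ • X := by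
  rw [lineProj, h, map_smul, smul_smul, smul_eq_mul, mul_inv_rev, mul_assoc,
    inv_mul_cancel₀ hs, mul_one]

theorem lineProj_inv_one {u v : Octonion} (hu : u ≠ 0) :
    lineProj u⁻¹ 1 (v * u⁻¹) = lineProj 1 u v :=
  lineProj_eq_of_outer_eq_smul (inv_ne_zero (norm_sq_ne hu)) (outer_inv_one hu)

theorem IsReflection.map_lineProj {L : Herm →ₗ[ℝ] Herm} (hL : IsReflection L)
    {a b c a' b' c' : Octonion} (h : L (outer a b c) = outer a' b' c') :
    L (lineProj a b c) = lineProj a' b' c' := by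
  rw [lineProj, map_smul, h, lineProj, ← h, hL.map_trace]

theorem swapHerm_lineProj (a b c : Octonion) : swapHerm (lineProj a b c) = lineProj b a c :=
  isReflection_swapHerm.map_lineProj (swapHerm_outer a b c)

/-! ### The embedding by projections -/

/-- The quadratic map whose zeros are the Hermitian matrices of rank at most one: Freudenthal's
adjugate, up to the signs coming from the indefinite form. -/
def adjugate (X : Herm) : Herm :=
  (diag₂ X * diag₃ X - ‖entry₂₃ X‖ ^ 2,
    diag₁ X * diag₃ X - ‖entry₁₃ X‖ ^ 2,
    diag₁ X * diag₂ X - ‖entry₁₂ X‖ ^ 2,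
    entry₁₃ X * conj (entry₂₃ X) - diag₃ X • entry₁₂ X,
    conj (entry₁₂ X) * entry₁₃ X - diag₁ X • entry₂₃ X,
    entry₁₂ X * entry₂₃ X - diag₂ X • entry₁₃ X)

theorem continuous_adjugate : Continuous adjugate := by
  have mul {f g : Herm → Octonion} (hf : Continuous f) (hg : Continuous g) :
      Continuous fun X => f X * g X := continuous_mul'.comp (hf.prodMk hg)
  have h₁ := mul entry₁₃.continuous (continuous_conj.comp entry₂₃.continuous)
  have h₂ := mul (continuous_conj.comp entry₁₂.continuous) entry₁₃.continuous
  have h₃ := mul entry₁₂.continuous entry₂₃.continuous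
  unfold adjugate
  fun_prop

theorem adjugate_smul (s : ℝ) (X : Herm) : adjugate (s • X) = s ^ 2 • adjugate X := by
  simp only [adjugate, map_smul, smul_eq_mul, norm_smul, Real.norm_eq_abs, mul_pow, sq_abs,
    conj_smul, smul_mul_smul_comm, Prod.smul_mk, Prod.mk.injEq, ← pow_two, smul_sub]
  refine ⟨by ring, by ring, by ring, by module, by module, by module⟩

theorem adjugate_swapHerm (X : Herm) : adjugate (swapHerm X) = swapHerm (adjugate X) := by
  simp only [adjugate, swapHerm_apply, diag₁_mk, diag₂_mk, diag₃_mk, entry₁₂_mk, entry₂₃_mk,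
    entry₁₃_mk, norm_conj, conj_conj, sub_eq_add_neg, conj_add, conj_neg, Octonion.conj_mul,
    conj_smul, mul_comm (diag₂ X)]

theorem adjugate_outer_one_left (u v : Octonion) : adjugate (outer 1 u v) = 0 := by
  simp [adjugate, outer, norm_one', norm_mul', norm_conj, mul_pow, conj_mul_mul, conj_mul,
    conj_conj]

theorem adjugate_outer_one_right (x y : Octonion) : adjugate (outer x y 1) = 0 := by
  simp [adjugate, outer, norm_one', norm_mul', norm_conj, mul_pow, mul_conj_mul, conj_mul,
    conj_conj, conj_one]

/-- The projections onto the lines on which the form `|a|² + |b|² - |c|²` is positive. -/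
def lineProjs : Set Herm :=
  {X | 0 ≤ diag₁ X ∧ 0 ≤ diag₂ X ∧ 0 ≤ diag₃ X ∧ trace X = 1 ∧ adjugate X = 0}

theorem isClosed_lineProjs : IsClosed lineProjs :=
  (isClosed_le continuous_const diag₁.continuous).and <|
    (isClosed_le continuous_const diag₂.continuous).and <|
      (isClosed_le continuous_const diag₃.continuous).and <|
        (isClosed_eq trace.continuous continuous_const).and <|
          isClosed_eq continuous_adjugate continuous_const

theorem lineProj_mem_lineProjs {a b c : Octonion} (ht : 0 < trace (outer a b c))
    (h : adjugate (outer a b c) = 0) : lineProj a b c ∈ lineProjs := by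
  have hd {d : ℝ} (hd : 0 ≤ d) : 0 ≤ (trace (outer a b c))⁻¹ * d := by positivity
  refine ⟨hd (sq_nonneg ‖a‖), hd (sq_nonneg ‖b‖), hd (sq_nonneg ‖c‖), ?_, ?_⟩
  · rw [lineProj, map_smul, smul_eq_mul, inv_mul_cancel₀ ht.ne']
  · rw [lineProj, adjugate_smul, h, smul_zero]

theorem swapHerm_mem_lineProjs {X : Herm} (h : X ∈ lineProjs) : swapHerm X ∈ lineProjs := by
  obtain ⟨h₁, h₂, h₃, ht, ha⟩ := h
  refine ⟨h₂, h₁, h₃, ?_, ?_⟩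
  · rw [isReflection_swapHerm.map_trace, ht]
  · rw [adjugate_swapHerm, ha, map_zero]

/-- The coordinates `(u, v)` of the line of `(1, u, v)` in terms of the projection onto it. -/
def coord₁ (X : Herm) : OctPair :=
  ((diag₁ X)⁻¹ • conj (entry₁₂ X), (diag₁ X)⁻¹ • conj (entry₁₃ X))

/-- The coordinates `(x, y)` of the line of `(x, y, 1)` in terms of the projection onto it. -/
def coord₃ (X : Herm) : OctPair := ((diag₃ X)⁻¹ • entry₁₃ X, (diag₃ X)⁻¹ • entry₂₃ X)

theorem coord₁_smul {s : ℝ} (hs : s ≠ 0) (X : Herm) : coord₁ (s • X) = coord₁ X := by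
  simp only [coord₁, map_smul, conj_smul, smul_smul, smul_eq_mul, mul_inv_rev, mul_assoc,
    inv_mul_cancel₀ hs, mul_one]

theorem coord₃_smul {s : ℝ} (hs : s ≠ 0) (X : Herm) : coord₃ (s • X) = coord₃ X := by
  simp only [coord₃, map_smul, smul_smul, smul_eq_mul, mul_inv_rev, mul_assoc,
    inv_mul_cancel₀ hs, mul_one]

theorem coord₁_lineProj {a b c : Octonion} (ht : trace (outer a b c) ≠ 0) :
    coord₁ (lineProj a b c) = (b * a⁻¹, c * a⁻¹) := by
  rw [lineProj, coord₁_smul (inv_ne_zero ht)]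
  simp only [coord₁, outer, diag₁_mk, entry₁₂_mk, entry₁₃_mk, Octonion.conj_mul, conj_conj,
    inv_def, mul_smul_comm]

theorem coord₃_lineProj {a b c : Octonion} (ht : trace (outer a b c) ≠ 0) :
    coord₃ (lineProj a b c) = (a * c⁻¹, b * c⁻¹) := by
  rw [lineProj, coord₃_smul (inv_ne_zero ht)]
  simp only [coord₃, outer, diag₃_mk, entry₂₃_mk, entry₁₃_mk, inv_def, mul_smul_comm]

theorem outer_one_coord₁ {X : Herm} (hX : adjugate X = 0) (h : diag₁ X ≠ 0) :
    outer 1 (coord₁ X).1 (coord₁ X).2 = (diag₁ X)⁻¹ • X := by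
  obtain ⟨α, β, γ, x, y, z⟩ := X
  simp only [adjugate, diag₁_mk, diag₂_mk, diag₃_mk, entry₁₂_mk, entry₂₃_mk, entry₁₃_mk,
    Prod.mk_eq_zero, sub_eq_zero] at hX h
  obtain ⟨-, hz, hx, -, hy, -⟩ := hX
  simp only [outer, coord₁, diag₁_mk, entry₁₂_mk, entry₁₃_mk, norm_one', norm_smul, norm_inv,
    Real.norm_eq_abs, mul_pow, inv_pow, sq_abs, norm_conj, conj_smul, conj_conj, one_mul,
    smul_mul_smul_comm, hy, ← hx, ← hz, Prod.smul_mk, smul_smul, smul_eq_mul, Prod.mk.injEq,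
    inv_mul_cancel₀ h, mul_assoc, mul_one, and_true]
  refine ⟨by norm_num, by field_simp, by field_simp⟩

theorem outer_coord₃_one {X : Herm} (hX : adjugate X = 0) (h : diag₃ X ≠ 0) :
    outer (coord₃ X).1 (coord₃ X).2 1 = (diag₃ X)⁻¹ • X := by
  obtain ⟨α, β, γ, x, y, z⟩ := X
  simp only [adjugate, diag₁_mk, diag₂_mk, diag₃_mk, entry₁₂_mk, entry₂₃_mk, entry₁₃_mk,
    Prod.mk_eq_zero, sub_eq_zero] at hX h
  obtain ⟨hy, hz, -, hx, -, -⟩ := hX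
  simp only [outer, coord₃, diag₃_mk, entry₂₃_mk, entry₁₃_mk, norm_one', norm_smul, norm_inv,
    Real.norm_eq_abs, mul_pow, inv_pow, sq_abs, conj_smul, conj_one, mul_one,
    smul_mul_smul_comm, hx, ← hy, ← hz, Prod.smul_mk, smul_smul, smul_eq_mul, Prod.mk.injEq,
    inv_mul_cancel₀ h, mul_assoc, mul_one, and_true]
  refine ⟨by field_simp, by field_simp, by norm_num⟩

theorem lineProj_one_coord₁ {X : Herm} (hX : X ∈ lineProjs) (h : diag₁ X ≠ 0) :
    lineProj 1 (coord₁ X).1 (coord₁ X).2 = X := by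
  obtain ⟨-, -, -, ht, ha⟩ := hX
  rw [lineProj_eq_of_outer_eq_smul (inv_ne_zero h) (outer_one_coord₁ ha h), ht, inv_one, one_smul]

theorem lineProj_coord₃_one {X : Herm} (hX : X ∈ lineProjs) (h : diag₃ X ≠ 0) :
    lineProj (coord₃ X).1 (coord₃ X).2 1 = X := by
  obtain ⟨-, -, -, ht, ha⟩ := hX
  rw [lineProj_eq_of_outer_eq_smul (inv_ne_zero h) (outer_coord₃_one ha h), ht, inv_one, one_smul]

theorem coord₁_mem_target {X : Herm} (hX : X ∈ lineProjs) (h : diag₁ X ≠ 0) :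
    coord₁ X ∈ target := by
  obtain ⟨h₁, -, -, ht, ha⟩ := hX
  change 0 < 1 + ‖(coord₁ X).1‖ ^ 2 - ‖(coord₁ X).2‖ ^ 2
  rw [← trace_outer_one, outer_one_coord₁ ha h, map_smul, ht, smul_eq_mul, mul_one]
  exact inv_pos.2 (h₁.lt_of_ne' h)

/-- The embedding of the plane into the Hermitian matrices that sends a line to the projection
onto it. -/
def emb (p : OP11) : Herm :=
  Quotient.lift (fun x : Coords => lineProj x.1.1 x.1.2.1 x.1.2.2) (fun x y h => by
    rcases rel_cases x.2 y.2 h with e | ⟨u, v, hu, ⟨e₁, e₂⟩ | ⟨e₁, e₂⟩⟩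
    · rw [e]
    · rw [e₁, e₂, lineProj_inv_one hu]
    · rw [e₁, e₂, lineProj_inv_one hu]) p

theorem emb_cls (x : Coords) : emb (cls x) = lineProj x.1.1 x.1.2.1 x.1.2.2 := rfl

theorem trace_outer_pos (x : Coords) : 0 < trace (outer x.1.1 x.1.2.1 x.1.2.2) := by
  obtain ⟨⟨a, b, c⟩, ⟨h, h'⟩ | ⟨h, h'⟩⟩ := x <;> simp only at h h' <;> subst h <;>
    simpa only [trace_outer, norm_one', one_pow] using h'

theorem emb_mem_lineProjs (p : OP11) : emb p ∈ lineProjs := by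
  induction p using ind with
  | h x =>
    rw [emb_cls]
    refine lineProj_mem_lineProjs (trace_outer_pos x) ?_
    rcases x.2 with ⟨h, -⟩ | ⟨h, -⟩ <;> rw [h]
    · exact adjugate_outer_one_left _ _
    · rw [← swapHerm_outer, adjugate_swapHerm, adjugate_outer_one_left, map_zero]

theorem coord₁_emb (p : OP11) : coord₁ (emb p) = φ₁ p := by
  induction p using ind with
  | h x => exact coord₁_lineProj (trace_outer_pos x).ne'

theorem coord₁_swapHerm_emb (p : OP11) : coord₁ (swapHerm (emb p)) = φ₂ p := by
  induction p using ind with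
  | h x =>
    rw [emb_cls, swapHerm_lineProj, φ₂_cls]
    refine coord₁_lineProj ?_
    rw [← swapHerm_outer, isReflection_swapHerm.map_trace]
    exact (trace_outer_pos x).ne'

theorem coord₃_emb (p : OP11) : coord₃ (emb p) = φ₃ p := by
  induction p using ind with
  | h x => exact coord₃_lineProj (trace_outer_pos x).ne'

theorem inv_trace_outer_mul_sq_ne_zero_iff (x : Coords) (a : Octonion) :
    (trace (outer x.1.1 x.1.2.1 x.1.2.2))⁻¹ * ‖a‖ ^ 2 ≠ 0 ↔ a ≠ 0 := by
  simp [(trace_outer_pos x).ne']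

theorem mem_D₁_iff {p : OP11} : p ∈ D₁ ↔ diag₁ (emb p) ≠ 0 := by
  induction p using ind with
  | h x => exact cls_mem_D₁.trans (inv_trace_outer_mul_sq_ne_zero_iff x _).symm

theorem mem_D₂_iff {p : OP11} : p ∈ D₂ ↔ diag₂ (emb p) ≠ 0 := by
  induction p using ind with
  | h x => exact cls_mem_D₂.trans (inv_trace_outer_mul_sq_ne_zero_iff x _).symm

theorem mem_D₃_iff {p : OP11} : p ∈ D₃ ↔ diag₃ (emb p) ≠ 0 := by
  constructor
  · rintro ⟨x, hx, rfl⟩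
    exact (inv_trace_outer_mul_sq_ne_zero_iff x _).2 hx
  · induction p using ind with
    | h x => exact fun h => ⟨x, (inv_trace_outer_mul_sq_ne_zero_iff x _).1 h, rfl⟩

theorem emb_pt₁ (w : target) : emb (pt₁ w) = lineProj 1 w.1.1 w.1.2 := rfl

theorem emb_pt₂ (w : target) : emb (pt₂ w) = lineProj w.1.1 1 w.1.2 := rfl

theorem range_emb : Set.range emb = lineProjs := by
  refine Set.Subset.antisymm (Set.range_subset_iff.2 emb_mem_lineProjs) fun X hX => ?_
  by_cases h₁ : diag₁ X = 0
  · have h₂ : diag₁ (swapHerm X) ≠ 0 := by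
      obtain ⟨-, -, h₃, ht, -⟩ := hX
      rw [trace_apply, h₁] at ht
      change diag₂ X ≠ 0
      linarith
    have hX' := swapHerm_mem_lineProjs hX
    refine ⟨pt₂ ⟨coord₁ (swapHerm X), coord₁_mem_target hX' h₂⟩, ?_⟩
    rw [emb_pt₂, ← swapHerm_lineProj, lineProj_one_coord₁ hX' h₂, isReflection_swapHerm.involutive]
  · exact ⟨pt₁ ⟨coord₁ X, coord₁_mem_target hX h₁⟩, lineProj_one_coord₁ hX h₁⟩

/-- The projection onto the line of `(1, u, v)` as a function of `w = (u, v)`. -/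
def param (w : OctPair) : Herm := lineProj 1 w.1 w.2

theorem trace_outer_one_ne_zero {w : OctPair} (hw : w ∈ target) :
    trace (outer 1 w.1 w.2) ≠ 0 := by
  rw [trace_outer_one]
  exact ne_of_gt hw

theorem coord₁_param {w : OctPair} (hw : w ∈ target) : coord₁ (param w) = w := by
  rw [param, coord₁_lineProj (trace_outer_one_ne_zero hw), inv_one', mul_one, mul_one]

section smoothness

variable {n : WithTop ℕ∞}

theorem contDiff_outer_one : ContDiff ℝ n fun w : OctPair => outer 1 w.1 w.2 := by
  have hfst : ContDiff ℝ n fun w : OctPair => conj w.1 := contDiff_conj.comp _root_.contDiff_fst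
  have hsnd : ContDiff ℝ n fun w : OctPair => conj w.2 := contDiff_conj.comp _root_.contDiff_snd
  have hmul : ContDiff ℝ n fun w : OctPair => w.1 * conj w.2 :=
    contDiff_mul'.comp (_root_.contDiff_fst.prodMk hsnd)
  simp only [outer, one_mul]
  exact contDiff_const.prodMk <| (_root_.contDiff_fst.norm_sq ℝ).prodMk <|
    (_root_.contDiff_snd.norm_sq ℝ).prodMk <| hfst.prodMk <| hmul.prodMk hsnd

theorem contDiffAt_param {w : OctPair} (hw : w ∈ target) : ContDiffAt ℝ n param w :=
  ((trace.contDiff.comp contDiff_outer_one).contDiffAt.inv (trace_outer_one_ne_zero hw)).smul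
    contDiff_outer_one.contDiffAt

theorem contDiffAt_coord₁ {X : Herm} (h : diag₁ X ≠ 0) : ContDiffAt ℝ n coord₁ X := by
  have hinv := diag₁.contDiff.contDiffAt (n := n) (x := X).inv h
  exact (hinv.smul (contDiff_conj.comp entry₁₂.contDiff).contDiffAt).prodMk
    (hinv.smul (contDiff_conj.comp entry₁₃.contDiff).contDiffAt)

end smoothness

/-- The differential of a vector-valued map on `OP11`, with values in the model space of the
source, which is definitionally equal to every tangent space. -/
def differential {F : Type*} [NormedAddCommGroup F] [NormedSpace ℝ F] (f : OP11 → F) (p : OP11) :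
    OctPair →L[ℝ] F :=
  mfderiv 𝓘(ℝ, OctPair) 𝓘(ℝ, F) f p

/-- A chart `e` is adapted to a reflection `A` that preserves the projections onto positive lines
if it reads `(u, v)` at the points that `A` carries to the line of `(1, u, v)`. -/
structure IsAdapted (e : OpenPartialHomeomorph OP11 OctPair) (A : Herm →ₗ[ℝ] Herm) : Prop where
  mem_atlas : e ∈ atlas OctPair OP11
  isReflection : IsReflection A
  mapsTo : Set.MapsTo A lineProjs lineProjs
  mem_source_iff (p : OP11) : p ∈ e.source ↔ diag₁ (A (emb p)) ≠ 0
  apply_eq (p : OP11) : e p = coord₁ (A (emb p))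

theorem isAdapted_chart₁ : IsAdapted chart₁ .id where
  mem_atlas := Or.inl rfl
  isReflection := .id
  mapsTo := Set.mapsTo_id _
  mem_source_iff _ := mem_D₁_iff
  apply_eq p := (coord₁_emb p).symm

theorem isAdapted_chart₂ : IsAdapted chart₂ swapHerm where
  mem_atlas := Or.inr rfl
  isReflection := isReflection_swapHerm
  mapsTo _ := swapHerm_mem_lineProjs
  mem_source_iff _ := mem_D₂_iff
  apply_eq p := (coord₁_swapHerm_emb p).symm

theorem exists_isAdapted_chartAt (p : OP11) : ∃ A, IsAdapted (chartAt OctPair p) A := by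
  by_cases h : p ∈ D₁
  · rw [show chartAt OctPair p = chart₁ from if_pos h]
    exact ⟨_, isAdapted_chart₁⟩
  · rw [show chartAt OctPair p = chart₂ from if_neg h]
    exact ⟨_, isAdapted_chart₂⟩

namespace IsAdapted

variable {e : OpenPartialHomeomorph OP11 OctPair} {A : Herm →ₗ[ℝ] Herm} (he : IsAdapted e A)
  {p : OP11}
include he

theorem mem_maximalAtlas : e ∈ IsManifold.maximalAtlas 𝓘(ℝ, OctPair) ∞ OP11 :=
  IsManifold.subset_maximalAtlas he.mem_atlas

theorem mem_target (hp : p ∈ e.source) : e p ∈ target :=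
  he.apply_eq p ▸ coord₁_mem_target (he.mapsTo (emb_mem_lineProjs p)) ((he.mem_source_iff p).1 hp)

theorem emb_eq (hp : p ∈ e.source) : emb p = A (param (e p)) := by
  rw [he.apply_eq, param, lineProj_one_coord₁ (he.mapsTo (emb_mem_lineProjs p))
    ((he.mem_source_iff p).1 hp), he.isReflection.involutive]

theorem emb_eventuallyEq (hp : p ∈ e.source) :
    emb =ᶠ[nhds p] (A.toContinuousLinearMap ∘ param) ∘ e :=
  (e.open_source.eventually_mem hp).mono fun _ hq => he.emb_eq hq

theorem contMDiffAt_emb (hp : p ∈ e.source) :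
    ContMDiffAt 𝓘(ℝ, OctPair) 𝓘(ℝ, Herm) ∞ emb p :=
  (A.toContinuousLinearMap.contDiff.contDiffAt.comp (e p)
    (contDiffAt_param (he.mem_target hp))).contMDiffAt.comp p
      (contMDiffAt_of_mem_maximalAtlas he.mem_maximalAtlas hp)
    |>.congr_of_eventuallyEq (he.emb_eventuallyEq hp)

theorem differential_emb (hp : p ∈ e.source) :
    differential emb p = A.toContinuousLinearMap ∘L fderiv ℝ param (e p) ∘L differential e p := by
  have hparam : DifferentiableAt ℝ param (e p) :=
    (contDiffAt_param (he.mem_target hp)).differentiableAt one_ne_zero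
  have hA : HasFDerivAt (A.toContinuousLinearMap ∘ param)
      (A.toContinuousLinearMap ∘L fderiv ℝ param (e p)) (e p) :=
    A.toContinuousLinearMap.hasFDerivAt.comp (e p) hparam.hasFDerivAt
  have hcomp := hA.hasMFDerivAt.comp p (mdifferentiableAt_atlas he.mem_atlas hp).hasMFDerivAt
  exact (hcomp.congr_of_eventuallyEq (he.emb_eventuallyEq hp)).mfderiv

end IsAdapted

theorem emb_injective : Function.Injective emb := by
  intro p q h
  obtain ⟨A, hA⟩ := exists_isAdapted_chartAt p
  have hp := mem_chart_source OctPair p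
  have hq : q ∈ (chartAt OctPair p).source := by
    rw [hA.mem_source_iff, ← h]
    exact (hA.mem_source_iff p).1 hp
  exact (chartAt OctPair p).injOn hp hq (by rw [hA.apply_eq, hA.apply_eq, h])

theorem contMDiff_emb : ContMDiff 𝓘(ℝ, OctPair) 𝓘(ℝ, Herm) ∞ emb := fun p =>
  (exists_isAdapted_chartAt p).elim fun _ hA => hA.contMDiffAt_emb (mem_chart_source OctPair p)

theorem contMDiff_of_emb_comp {E H N : Type*} [NormedAddCommGroup E] [NormedSpace ℝ E]
    [TopologicalSpace H] {I : ModelWithCorners ℝ E H} [TopologicalSpace N] [ChartedSpace H N]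
    {f : N → OP11} (hf : ContMDiff I 𝓘(ℝ, Herm) ∞ (emb ∘ f)) :
    ContMDiff I 𝓘(ℝ, OctPair) ∞ f := by
  intro x
  obtain ⟨A, hA⟩ := exists_isAdapted_chartAt (f x)
  set e := chartAt OctPair (f x)
  have hx : f x ∈ e.source := mem_chart_source OctPair (f x)
  have hAf : ContMDiff I 𝓘(ℝ, Herm) ∞ fun y => A (emb (f y)) :=
    A.toContinuousLinearMap.contMDiff.comp hf
  have hne : diag₁ (A (emb (f x))) ≠ 0 := (hA.mem_source_iff _).1 hx
  have hcoord : ContMDiffAt I 𝓘(ℝ, OctPair) ∞ (fun y => coord₁ (A (emb (f y)))) x :=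
    (contDiffAt_coord₁ hne).contMDiffAt.comp x (hAf x)
  have hsymm : ContMDiffAt 𝓘(ℝ, OctPair) 𝓘(ℝ, OctPair) ∞ e.symm (coord₁ (A (emb (f x)))) := by
    rw [← hA.apply_eq]
    exact contMDiffAt_symm_of_mem_maximalAtlas hA.mem_maximalAtlas (e.map_source hx)
  refine (hsymm.comp x hcoord).congr_of_eventuallyEq ?_
  filter_upwards [(diag₁.continuous.comp hAf.continuous).continuousAt.eventually_ne hne] with y hy
  have hy' : f y ∈ e.source := (hA.mem_source_iff _).2 hy
  change f y = e.symm (coord₁ (A (emb (f y))))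
  rw [← hA.apply_eq, e.left_inv hy']

/-! ### The metric -/

section pullback

variable {E : Type*} [NormedAddCommGroup E] [NormedSpace ℝ E]

/-- Half the pullback of the trace form under a linear map. -/
def halfPullback (T : E →L[ℝ] Herm) : E →L[ℝ] E →L[ℝ] ℝ :=
  (2 : ℝ)⁻¹ • traceForm.bilinearComp T T

theorem halfPullback_apply (T : E →L[ℝ] Herm) (x y : E) :
    halfPullback T x y = 2⁻¹ * traceForm (T x) (T y) := rfl

theorem halfPullback_comm (T : E →L[ℝ] Herm) (x y : E) :
    halfPullback T x y = halfPullback T y x := by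
  rw [halfPullback_apply, halfPullback_apply, traceForm_comm]

set_option maxSynthPendingDepth 3 in
theorem contDiff_halfPullback {n : WithTop ℕ∞} :
    ContDiff ℝ n (halfPullback : (E →L[ℝ] Herm) → E →L[ℝ] E →L[ℝ] ℝ) := by
  have hleft : ContDiff ℝ n fun T : E →L[ℝ] Herm => (traceForm ∘L T).flip :=
    (ContinuousLinearMap.flipₗᵢ ℝ E Herm ℝ).contDiff.comp
      (show ContDiff ℝ n fun T : E →L[ℝ] Herm => traceForm ∘L T from
        contDiff_const.clm_comp contDiff_id)
  have hright : ContDiff ℝ n fun T : E →L[ℝ] Herm => ((traceForm ∘L T).flip ∘L T).flip :=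
    (ContinuousLinearMap.flipₗᵢ ℝ E E ℝ).contDiff.comp
      (show ContDiff ℝ n fun T : E →L[ℝ] Herm => (traceForm ∘L T).flip ∘L T from
        hleft.clm_comp contDiff_id)
  exact hright.const_smul (2 : ℝ)⁻¹

end pullback

/-- The derivative of `w ↦ outer 1 w.1 w.2` at `w` in the direction `ξ`. -/
def outerDeriv (w ξ : OctPair) : Herm :=
  (0, 2 * ⟪w.1, ξ.1⟫_ℝ, 2 * ⟪w.2, ξ.2⟫_ℝ, conj ξ.1, ξ.1 * conj w.2 + w.1 * conj ξ.2, conj ξ.2)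

theorem outer_one_add_smul (w ξ : OctPair) (s : ℝ) :
    outer 1 (w + s • ξ).1 (w + s • ξ).2 = outer 1 w.1 w.2 + s • outerDeriv w ξ +
      s ^ 2 • ((0, ‖ξ.1‖ ^ 2, ‖ξ.2‖ ^ 2, 0, ξ.1 * conj ξ.2, 0) : Herm) := by
  simp only [outer, outerDeriv, Prod.fst_add, Prod.snd_add, Prod.smul_fst, Prod.smul_snd,
    norm_add_sq_real, conj_add, conj_smul, mul_add, add_mul, smul_mul_assoc, mul_smul_comm,
    norm_smul, mul_pow, Real.norm_eq_abs, sq_abs, real_inner_smul_right, one_mul, Prod.mk_add_mk,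
    Prod.smul_mk, smul_eq_mul, Prod.mk.injEq, mul_zero, add_zero, smul_zero, true_and, and_true]
  exact ⟨by ring, by ring, by module⟩

theorem hasDerivAt_outer_one (w ξ : OctPair) :
    HasDerivAt (fun s : ℝ => outer 1 (w + s • ξ).1 (w + s • ξ).2) (outerDeriv w ξ) 0 := by
  simp only [outer_one_add_smul]
  have hlin := ((hasDerivAt_id (0 : ℝ)).smul_const (outerDeriv w ξ)).const_add (outer 1 w.1 w.2)
  have hsq := ((hasDerivAt_id (0 : ℝ)).pow 2).smul_const
    ((0, ‖ξ.1‖ ^ 2, ‖ξ.2‖ ^ 2, 0, ξ.1 * conj ξ.2, 0) : Herm)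
  simpa using! hlin.add hsq

theorem fderiv_param {w : OctPair} (hw : w ∈ target) (ξ : OctPair) :
    fderiv ℝ param w ξ = (trace (outer 1 w.1 w.2))⁻¹ • outerDeriv w ξ -
      (trace (outerDeriv w ξ) / trace (outer 1 w.1 w.2) ^ 2) • outer 1 w.1 w.2 := by
  have hparam : DifferentiableAt ℝ param w := (contDiffAt_param hw).differentiableAt one_ne_zero
  have houter := hasDerivAt_outer_one w ξ
  have htrace : HasDerivAt (fun s : ℝ => trace (outer 1 (w + s • ξ).1 (w + s • ξ).2))
      (trace (outerDeriv w ξ)) 0 := trace.hasFDerivAt.comp_hasDerivAt (0 : ℝ) houter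
  have hquot := (htrace.inv (by simpa using trace_outer_one_ne_zero hw)).smul houter
  rw [← hparam.lineDeriv_eq_fderiv, lineDeriv]
  refine hquot.deriv.trans ?_
  simp only [Pi.inv_apply, zero_smul, add_zero, neg_div, neg_smul, sub_eq_add_neg]

theorem traceForm_outer_one (w : OctPair) :
    traceForm (outer 1 w.1 w.2) (outer 1 w.1 w.2) = trace (outer 1 w.1 w.2) ^ 2 := by
  rw [trace_outer]
  simp only [traceForm_self, outer, diag₁_mk, diag₂_mk, diag₃_mk, entry₁₂_mk, entry₂₃_mk,
    entry₁₃_mk, norm_sq_mul, norm_conj, norm_one']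
  ring

theorem trace_outerDeriv (w ξ : OctPair) :
    trace (outerDeriv w ξ) = 2 * ⟪w.1, ξ.1⟫_ℝ - 2 * ⟪w.2, ξ.2⟫_ℝ := by
  rw [trace_apply, outerDeriv, diag₁_mk, diag₂_mk, diag₃_mk, zero_add]

theorem traceForm_outerDeriv_outer (w ξ : OctPair) :
    traceForm (outerDeriv w ξ) (outer 1 w.1 w.2) =
      trace (outer 1 w.1 w.2) * trace (outerDeriv w ξ) := by
  rw [trace_outerDeriv, trace_outer_one, traceForm_comm]
  simp only [traceForm_apply, outer, outerDeriv, diag₁_mk, diag₂_mk, diag₃_mk, entry₁₂_mk,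
    entry₂₃_mk, entry₁₃_mk, one_mul, inner_conj_conj, inner_add_right, inner_mul_mul_left,
    inner_mul_mul_right, norm_conj]
  ring

theorem traceForm_outerDeriv (w ξ : OctPair) :
    traceForm (outerDeriv w ξ) (outerDeriv w ξ) = trace (outerDeriv w ξ) ^ 2 +
      2 * (‖ξ.1‖ ^ 2 * (1 - ‖w.2‖ ^ 2) - ‖ξ.2‖ ^ 2 * (1 + ‖w.1‖ ^ 2)
        + 2 * re ((w.1 * conj w.2) * (ξ.2 * conj ξ.1))) := by
  have hre : re ((w.1 * conj w.2) * (ξ.2 * conj ξ.1)) = ⟪ξ.1 * conj ξ.2, w.1 * conj w.2⟫_ℝ := by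
    rw [re_mul_eq_inner, Octonion.conj_mul, conj_conj, real_inner_comm]
  have hinner := inner_mul_mul_add ξ.1 w.1 (conj w.2) (conj ξ.2)
  rw [inner_conj_conj, real_inner_comm w.1 ξ.1] at hinner
  rw [trace_outerDeriv, hre, traceForm_self]
  simp only [outerDeriv, diag₁_mk, diag₂_mk, diag₃_mk, entry₁₂_mk, entry₂₃_mk, entry₁₃_mk,
    norm_conj, norm_add_sq_real, norm_sq_mul]
  linear_combination (-4) * hinner

theorem halfPullback_fderiv_param_self {w : OctPair} (hw : w ∈ target) (ξ : OctPair) :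
    halfPullback (fderiv ℝ param w) ξ ξ = dsSq w ξ := by
  have htrace := trace_outer_one_ne_zero hw
  rw [halfPullback_apply, fderiv_param hw, dsSq, ← trace_outer_one]
  simp only [map_sub, map_smul, sub_apply, smul_apply, smul_eq_mul,
    traceForm_comm (outer 1 w.1 w.2) (outerDeriv w ξ), traceForm_outerDeriv_outer,
    traceForm_outer_one, traceForm_outerDeriv]
  field_simp
  ring

/-- The linear map whose graph is the `ds²`-orthogonal complement of the `v`-directions. -/
def slope (w : OctPair) : Octonion →ₗ[ℝ] Octonion :=
  (1 + ‖w.1‖ ^ 2)⁻¹ • LinearMap.mulLeft ℝ (w.2 * conj w.1)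

theorem slope_apply (w : OctPair) (x : Octonion) :
    slope w x = (1 + ‖w.1‖ ^ 2)⁻¹ • ((w.2 * conj w.1) * x) := rfl

theorem dsSq_slope {w : OctPair} (hw : w ∈ target) (x : Octonion) :
    dsSq w (x, slope w x) =
      ‖x‖ ^ 2 / ((1 + ‖w.1‖ ^ 2) * (1 + ‖w.1‖ ^ 2 - ‖w.2‖ ^ 2)) := by
  have hN : 1 + ‖w.1‖ ^ 2 - ‖w.2‖ ^ 2 ≠ 0 := ne_of_gt hw
  have hC : 1 + ‖w.1‖ ^ 2 ≠ 0 := by positivity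
  have hre : re ((w.1 * conj w.2) * (slope w x * conj x)) =
      (1 + ‖w.1‖ ^ 2)⁻¹ * (‖w.1‖ ^ 2 * ‖w.2‖ ^ 2 * ‖x‖ ^ 2) := by
    have hslope : slope w x * conj x = (1 + ‖w.1‖ ^ 2)⁻¹ • ‖x‖ ^ 2 • conj (w.1 * conj w.2) := by
      rw [slope_apply, smul_mul_assoc, mul_mul_conj, Octonion.conj_mul, conj_conj]
    rw [hslope, re_mul_eq_inner, conj_smul, conj_smul, conj_conj, real_inner_smul_right,
      real_inner_smul_right, real_inner_self_eq_norm_sq, norm_sq_mul, norm_conj]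
    ring
  rw [dsSq, hre]
  simp only [slope_apply, norm_smul, mul_pow, norm_sq_mul, norm_conj, norm_inv, Real.norm_eq_abs,
    sq_abs, inv_pow]
  field_simp
  ring

theorem dsSq_zero_left (w : OctPair) (y : Octonion) :
    dsSq w (0, y) = -(‖y‖ ^ 2 * (1 + ‖w.1‖ ^ 2) / (1 + ‖w.1‖ ^ 2 - ‖w.2‖ ^ 2) ^ 2) := by
  have hre : re ((w.1 * conj w.2) * (y * conj 0)) = 0 := by
    rw [re_mul_eq_inner, Octonion.conj_mul, conj_conj, zero_mul, inner_zero_right]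
  rw [dsSq, hre, norm_zero]
  ring

theorem sigPos_sigNeg_radical_of_dsSq {W : Type*} [AddCommGroup W] [Module ℝ W]
    {Q : QuadraticForm ℝ W} (e : W ≃ₗ[ℝ] OctPair) {w : OctPair} (hw : w ∈ target)
    (hQ : ∀ X, Q X = dsSq w (e X)) :
    _root_.sigPos Q = 8 ∧ _root_.sigNeg Q = 8 ∧ Q.radical = ⊥ := by
  have hN : 0 < 1 + ‖w.1‖ ^ 2 - ‖w.2‖ ^ 2 := hw
  have : FiniteDimensional ℝ W := e.symm.finiteDimensional
  rw [← Octonion.finrank_eq]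
  refine sigPos_sigNeg_radical_of_pos_of_neg
    (e.symm.toLinearMap ∘ₗ LinearMap.prod .id (slope w)) (fun x hx => ?_)
    (e.symm.toLinearMap ∘ₗ LinearMap.inr ℝ Octonion Octonion) (fun y hy => ?_) ?_
  · rw [hQ, LinearMap.comp_apply, LinearEquiv.coe_coe, e.apply_symm_apply]
    refine (dsSq_slope hw x).symm ▸ ?_
    positivity
  · rw [hQ, LinearMap.comp_apply, LinearEquiv.coe_coe, e.apply_symm_apply, LinearMap.inr_apply,
      dsSq_zero_left, neg_lt_zero]
    positivity
  · rw [e.finrank_eq, Module.finrank_prod]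

/-- The value of the metric at a point: half the pullback of the trace form under `emb`. -/
def metricVal (p : OP11) : OctPair →L[ℝ] OctPair →L[ℝ] ℝ := halfPullback (differential emb p)

namespace IsAdapted

variable {e : OpenPartialHomeomorph OP11 OctPair} {A : Herm →ₗ[ℝ] Herm} (he : IsAdapted e A)
  {p : OP11} (hp : p ∈ e.source)
include he hp

theorem metricVal_eq (X Y : OctPair) : metricVal p X Y =
    halfPullback (fderiv ℝ param (e p)) (differential e p X) (differential e p Y) := by
  have hA (Z : OctPair) :
      differential emb p Z = A (fderiv ℝ param (e p) (differential e p Z)) := by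
    rw [he.differential_emb hp]; rfl
  rw [metricVal, halfPullback_apply, hA, hA, he.isReflection.map_traceForm, halfPullback_apply]

theorem metricVal_self (X : OctPair) : metricVal p X X = dsSq (e p) (differential e p X) := by
  rw [he.metricVal_eq hp, halfPullback_fderiv_param_self (he.mem_target hp)]

end IsAdapted

theorem sigPos_sigNeg_radical_of_metricVal {p : OP11} {Q : QuadraticForm ℝ OctPair}
    (hQ : ∀ X, Q X = metricVal p X X) :
    _root_.sigPos Q = 8 ∧ _root_.sigNeg Q = 8 ∧ Q.radical = ⊥ := by
  obtain ⟨A, hA⟩ := exists_isAdapted_chartAt p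
  have hp := mem_chart_source OctPair p
  have he := mdifferentiable_of_mem_atlas (I := 𝓘(ℝ, OctPair)) hA.mem_atlas
  exact sigPos_sigNeg_radical_of_dsSq (he.mfderiv hp).toLinearEquiv (hA.mem_target hp) fun X =>
    (hQ X).trans (hA.metricVal_self hp X)

theorem eq_zero_of_metricVal_eq_zero {p : OP11} {X : OctPair} (hX : ∀ Y, metricVal p X Y = 0) :
    X = 0 := by
  have hsymm (Y : OctPair) : metricVal p Y X = 0 := by rw [metricVal, halfPullback_comm]; exact hX Y
  let Q : QuadraticForm ℝ OctPair :=
    LinearMap.BilinMap.toQuadraticMap (metricVal p).toLinearMap₁₂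
  have hQ (Y : OctPair) : Q Y = metricVal p Y Y := rfl
  obtain ⟨-, -, hradical⟩ := sigPos_sigNeg_radical_of_metricVal hQ
  rw [← Submodule.mem_bot ℝ, ← hradical, QuadraticMap.mem_radical_iff']
  refine ⟨hX X, fun Y => ?_⟩
  rw [hQ, hQ, map_add, map_add, add_apply, add_apply, hX, hX, hsymm, zero_add,
    zero_add, zero_add]

/-- The semi-Riemannian metric `ds²` of the plane. -/
def metric : SemiRiemannianMetric OctPair OP11 where
  val := metricVal
  symm p := halfPullback_comm (differential emb p)
  nondegenerate _ _ hX := eq_zero_of_metricVal_eq_zero hX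
  contMDiff p := by
    obtain ⟨A, hA⟩ := exists_isAdapted_chartAt p
    have hfderiv : ContDiffAt ℝ ∞ (fderiv ℝ param) (chartAt OctPair p p) :=
      (contDiffAt_param (n := ∞) (hA.mem_target (mem_chart_source OctPair p))).fderiv_right le_rfl
    exact contMDiffAt_bilinearForm_of_chartAt metricVal p
      (contDiff_halfPullback.contDiffAt.comp _ hfderiv) fun _ hq => hA.metricVal_eq hq

theorem isGivenByDsSq_metric : IsGivenByDsSq metric :=
  ⟨fun _ => isAdapted_chart₁.metricVal_self, fun _ => isAdapted_chart₂.metricVal_self⟩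

theorem eq_of_isGivenByDsSq {g g' : SemiRiemannianMetric OctPair OP11} (h : IsGivenByDsSq g)
    (h' : IsGivenByDsSq g') : g = g' :=
  SemiRiemannianMetric.ext_of_val_self fun p X => by
    rcases mem_D₁_or_D₂ p with hp | hp
    · rw [h.1 p hp, h'.1 p hp]
    · rw [h.2 p hp, h'.2 p hp]

theorem hasSignature_metric : metric.HasSignature 8 8 := fun p =>
  have h := sigPos_sigNeg_radical_of_metricVal (Q := metric.quadraticForm p) fun _ => rfl
  ⟨h.1, h.2.1⟩

/-! ### Extension of the reflections -/

theorem chart₁_symm_of_mem {w : OctPair} (hw : w ∈ target) : chart₁.symm w = pt₁ ⟨w, hw⟩ :=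
  ψ₁_of_mem hw

theorem chart₂_symm_of_mem {w : OctPair} (hw : w ∈ target) : chart₂.symm w = pt₂ ⟨w, hw⟩ :=
  ψ₂_of_mem hw

theorem dense_D₁ : Dense D₁ := fun _ => (mem_D₁_or_D₂ _).elim (fun h => subset_closure h) <|
  fun h => source_subset_closure_of_dense chart₂ dense_fst_ne_zero
    (fun w hw hu => by rw [chart₂_symm_of_mem hw]; exact cls_mem_D₁.2 hu) h

theorem dense_D₂ : Dense D₂ := fun _ => (mem_D₁_or_D₂ _).symm.elim (fun h => subset_closure h) <|
  fun h => source_subset_closure_of_dense chart₁ dense_fst_ne_zero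
    (fun w hw hu => by rw [chart₁_symm_of_mem hw]; exact cls_mem_D₂.2 hu) h

theorem dense_D₃ : Dense D₃ := fun _ => (mem_D₁_or_D₂ _).elim
  (fun h => source_subset_closure_of_dense chart₁ dense_snd_ne_zero
    (fun w hw hv => by rw [chart₁_symm_of_mem hw]; exact ⟨_, hv, rfl⟩) h)
  (fun h => source_subset_closure_of_dense chart₂ dense_snd_ne_zero
    (fun w hw hv => by rw [chart₂_symm_of_mem hw]; exact ⟨_, hv, rfl⟩) h)

theorem emb_eq_of_mem_D₃ {p : OP11} (hp : p ∈ D₃) : emb p = lineProj (φ₃ p).1 (φ₃ p).2 1 := by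
  rw [← coord₃_emb, lineProj_coord₃_one (emb_mem_lineProjs p) (mem_D₃_iff.1 hp)]

theorem injOn_φ₃ : Set.InjOn φ₃ D₃ := fun p hp q hq h =>
  emb_injective (by rw [emb_eq_of_mem_D₃ hp, emb_eq_of_mem_D₃ hq, h])

theorem Extends.unique {D : Set OP11} {φ : OP11 → OctPair} {f : OctPair → OctPair}
    {F F' : Equiv.Perm OP11} (h : Extends F D φ f) (h' : Extends F' D φ f) (hD : Dense D)
    (hφ : Set.InjOn φ D) (hF : Continuous F) (hF' : Continuous F') : F' = F :=
  Equiv.coe_fn_injective <| hF'.ext_on hD hF fun p hp =>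
    hφ (h' p hp).1 (h p hp).1 ((h' p hp).2.trans (h p hp).2.symm)

theorem mapsTo_lineProjs_of_dense (L : Herm →ₗ[ℝ] Herm) {D : Set OP11} (hD : Dense D)
    (hLD : ∀ p ∈ D, L (emb p) ∈ lineProjs) : Set.MapsTo L lineProjs lineProjs := by
  have hclosed : IsClosed {p : OP11 | L (emb p) ∈ lineProjs} :=
    isClosed_lineProjs.preimage (L.toContinuousLinearMap.continuous.comp contMDiff_emb.continuous)
  rw [← range_emb]
  rintro _ ⟨p, rfl⟩
  rw [range_emb]
  exact closure_minimal hLD hclosed (hD p)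

namespace IsReflection

variable {L : Herm →ₗ[ℝ] Herm} (hL : IsReflection L)
include hL

theorem exists_perm (hmaps : Set.MapsTo L lineProjs lineProjs) :
    ∃ F : Equiv.Perm OP11, ∀ p, emb (F p) = L (emb p) := by
  have hrange (p : OP11) : ∃ q, emb q = L (emb p) := range_emb.ge (hmaps (emb_mem_lineProjs p))
  choose f hf using hrange
  have hf_invol : Function.Involutive f := fun p => emb_injective (by rw [hf, hf, hL.involutive])
  exact ⟨hf_invol.toPerm f, hf⟩

variable {F : Equiv.Perm OP11} (hF : ∀ p, emb (F p) = L (emb p))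
include hF

theorem perm_mul_self : F * F = 1 :=
  Equiv.ext fun p => emb_injective <|
    show emb (F (F p)) = emb p by rw [hF, hF, hL.involutive]

theorem isIsometry_perm : metric.IsIsometry F := by
  have hcomp : emb ∘ F = L.toContinuousLinearMap ∘ emb := funext hF
  have hsmooth : ContMDiff 𝓘(ℝ, OctPair) 𝓘(ℝ, OctPair) ∞ F :=
    contMDiff_of_emb_comp (hcomp ▸ L.toContinuousLinearMap.contMDiff.comp contMDiff_emb)
  have hsymm : F.symm = F := (eq_inv_of_mul_eq_one_left (hL.perm_mul_self hF)).symm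
  refine ⟨hsmooth, hsymm ▸ hsmooth, fun p X Y => ?_⟩
  have hemb (q : OP11) : MDifferentiableAt 𝓘(ℝ, OctPair) 𝓘(ℝ, Herm) emb q :=
    contMDiff_emb.mdifferentiable (by simp) q
  have hderiv (Z : OctPair) :
      differential emb (F p) (mfderiv 𝓘(ℝ, OctPair) 𝓘(ℝ, OctPair) F p Z) =
        L (differential emb p Z) := by
    have hleft := mfderiv_comp p (hemb (F p)) (hsmooth.mdifferentiable (by simp) p)
    have hright := mfderiv_comp p (I' := 𝓘(ℝ, Herm)) (I'' := 𝓘(ℝ, Herm))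
      L.toContinuousLinearMap.differentiableAt.mdifferentiableAt (hemb p)
    rw [hcomp, hright, mfderiv_eq_fderiv, ContinuousLinearMap.fderiv] at hleft
    exact (DFunLike.congr_fun hleft Z).symm
  have hval {X Y X' Y' : OctPair} (hX : differential emb (F p) X' = L (differential emb p X))
      (hY : differential emb (F p) Y' = L (differential emb p Y)) :
      metricVal (F p) X' Y' = metricVal p X Y := by
    rw [metricVal, metricVal, halfPullback_apply, halfPullback_apply, hX, hY, hL.map_traceForm]
  exact hval (hderiv X) (hderiv Y)

theorem extendsToUniqueInvolutiveIsometry {D : Set OP11} {φ : OP11 → OctPair}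
    {f : OctPair → OctPair} (hD : Dense D) (hφ : Set.InjOn φ D) (hext : Extends F D φ f) :
    ExtendsToUniqueInvolutiveIsometry metric D φ f :=
  ⟨F, hL.isIsometry_perm hF, hext, hL.perm_mul_self hF, fun _ hF' hext' =>
    hext.unique hext' hD hφ (hL.isIsometry_perm hF).1.continuous hF'.1.continuous⟩

end IsReflection

theorem IsReflection.exists_extends {L : Herm →ₗ[ℝ] Herm} (hL : IsReflection L) {D : Set OP11}
    (hD : Dense D) {φ : OP11 → OctPair} {f : OctPair → OctPair}
    (h : ∀ p ∈ D, ∃ q ∈ D, emb q = L (emb p) ∧ φ q = f (φ p)) :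
    ∃ F : Equiv.Perm OP11, (∀ p, emb (F p) = L (emb p)) ∧ Extends F D φ f := by
  obtain ⟨F, hF⟩ := hL.exists_perm <| mapsTo_lineProjs_of_dense L hD fun p hp => by
    obtain ⟨q, -, hq, -⟩ := h p hp
    exact hq ▸ emb_mem_lineProjs q
  refine ⟨F, hF, fun p hp => ?_⟩
  obtain ⟨q, hqD, hq, hφq⟩ := h p hp
  rw [emb_injective ((hF p).trans hq.symm)]
  exact ⟨hqD, hφq⟩

theorem IsAdapted.exists_emb_eq {e : OpenPartialHomeomorph OP11 OctPair} {A : Herm →ₗ[ℝ] Herm}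
    (he : IsAdapted e A) {w : OctPair} (hw : w ∈ target) :
    ∃ q ∈ e.source, emb q = A (param w) ∧ e q = w := by
  have hparam : param w ∈ lineProjs := emb_mem_lineProjs (pt₁ ⟨w, hw⟩)
  obtain ⟨q, hq⟩ := range_emb.ge (he.mapsTo hparam)
  refine ⟨q, ?_, hq, ?_⟩
  · rw [he.mem_source_iff, hq, he.isReflection.involutive]
    exact mem_D₁_iff.1 (mem_D₁.2 ⟨⟨w, hw⟩, rfl⟩)
  · rw [he.apply_eq, hq, he.isReflection.involutive, coord₁_param hw]

theorem indefRefl_mem_target {r : ℝ} {l : Octonion} (h : r ^ 2 - ‖l‖ ^ 2 = 1) {w : OctPair}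
    (hw : w ∈ target) : indefRefl r l w ∈ target := by
  have htrace := (isReflection_indefHerm h).map_trace (outer 1 w.1 w.2)
  rw [indefHerm_outer h, trace_outer_one, trace_outer_one] at htrace
  exact lt_of_lt_of_eq hw htrace.symm

theorem indefHerm_param {r : ℝ} {l : Octonion} (h : r ^ 2 - ‖l‖ ^ 2 = 1) (w : OctPair) :
    indefHerm r l (param w) = param (indefRefl r l w) :=
  (isReflection_indefHerm h).map_lineProj (indefHerm_outer h w)

theorem IsAdapted.exists_extends_indefRefl {e : OpenPartialHomeomorph OP11 OctPair}
    {A : Herm →ₗ[ℝ] Herm} (he : IsAdapted e A) (hdense : Dense e.source) {r : ℝ} {l : Octonion}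
    (h : r ^ 2 - ‖l‖ ^ 2 = 1) :
    ∃ F : Equiv.Perm OP11, (∀ p, emb (F p) = (A ∘ₗ indefHerm r l ∘ₗ A) (emb p)) ∧
      Extends F e.source e (indefRefl r l) := by
  refine (he.isReflection.conjugate (isReflection_indefHerm h)).exists_extends hdense
    fun p hp => ?_
  obtain ⟨q, hq, hemb, heq⟩ := he.exists_emb_eq (indefRefl_mem_target h (he.mem_target hp))
  refine ⟨q, hq, ?_, heq⟩
  rw [hemb, he.emb_eq hp, LinearMap.comp_apply, LinearMap.comp_apply, he.isReflection.involutive,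
    indefHerm_param h]

theorem IsAdapted.indefRefl_extendsToUniqueInvolutiveIsometry
    {e : OpenPartialHomeomorph OP11 OctPair} {A : Herm →ₗ[ℝ] Herm} (he : IsAdapted e A)
    (hdense : Dense e.source) {r : ℝ} {l : Octonion} (h : r ^ 2 - ‖l‖ ^ 2 = 1) :
    ExtendsToUniqueInvolutiveIsometry metric e.source e (indefRefl r l) := by
  obtain ⟨F, hF, hext⟩ := he.exists_extends_indefRefl hdense h
  exact (he.isReflection.conjugate (isReflection_indefHerm h)).extendsToUniqueInvolutiveIsometry hF
    hdense e.injOn hext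

theorem trace_outer_φ₃_pos {p : OP11} (hp : p ∈ D₃) :
    0 < trace (outer (φ₃ p).1 (φ₃ p).2 1) := by
  have hemb := emb_mem_lineProjs p
  rw [← coord₃_emb, outer_coord₃_one hemb.2.2.2.2 (mem_D₃_iff.1 hp), map_smul, hemb.2.2.2.1,
    smul_eq_mul, mul_one]
  exact inv_pos.2 (hemb.2.2.1.lt_of_ne' (mem_D₃_iff.1 hp))

theorem exists_mem_D₃_emb_eq {x y : Octonion} (h : 0 < trace (outer x y 1)) :
    ∃ q ∈ D₃, emb q = lineProj x y 1 ∧ φ₃ q = (x, y) := by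
  obtain ⟨q, hq⟩ := range_emb.ge (lineProj_mem_lineProjs h (adjugate_outer_one_right x y))
  refine ⟨q, ?_, hq, ?_⟩
  · rw [mem_D₃_iff, hq, lineProj, map_smul, smul_eq_mul]
    simpa [outer, norm_one'] using h.ne'
  · rw [← coord₃_emb, hq, coord₃_lineProj h.ne', inv_one', mul_one, mul_one]

theorem exists_extends_euclRefl {r : ℝ} {l : Octonion} (h : r ^ 2 + ‖l‖ ^ 2 = 1) :
    ∃ F : Equiv.Perm OP11, (∀ p, emb (F p) = euclHerm r l (emb p)) ∧
      Extends F D₃ φ₃ (euclRefl r l) := by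
  have hL := isReflection_euclHerm h
  refine hL.exists_extends dense_D₃ fun p hp => ?_
  have htrace := trace_outer_φ₃_pos hp
  rw [← hL.map_trace, euclHerm_outer h] at htrace
  obtain ⟨q, hq, hemb, heq⟩ := exists_mem_D₃_emb_eq htrace
  exact ⟨q, hq, by rw [hemb, emb_eq_of_mem_D₃ hp, hL.map_lineProj (euclHerm_outer h (φ₃ p))], heq⟩

theorem euclRefl_extendsToUniqueInvolutiveIsometry {r : ℝ} {l : Octonion}
    (h : r ^ 2 + ‖l‖ ^ 2 = 1) :
    ExtendsToUniqueInvolutiveIsometry metric D₃ φ₃ (euclRefl r l) := by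
  obtain ⟨F, hF, hext⟩ := exists_extends_euclRefl h
  exact (isReflection_euclHerm h).extendsToUniqueInvolutiveIsometry hF dense_D₃ injOn_φ₃ hext

/-! ### Transitivity -/

/-- The group generated by the isometries that extend indefinite and Euclidean reflections. -/
def reflectionGroup : Subgroup (Equiv.Perm OP11) :=
  Subgroup.closure {F : Equiv.Perm OP11 | metric.IsIsometry F ∧ ExtendsReflection F}

theorem reflectionGroup_le_isometryGroup : reflectionGroup ≤ metric.isometryGroup :=
  (Subgroup.closure_le _).2 fun _ hF => hF.1

theorem exists_mem_reflectionGroup_emb_eq_euclHerm {r : ℝ} {l : Octonion}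
    (h : r ^ 2 + ‖l‖ ^ 2 = 1) :
    ∃ F ∈ reflectionGroup, ∀ p, emb (F p) = euclHerm r l (emb p) := by
  obtain ⟨F, hF, hext⟩ := exists_extends_euclRefl h
  exact ⟨F, Subgroup.subset_closure
    ⟨(isReflection_euclHerm h).isIsometry_perm hF, Or.inr ⟨r, l, h, hext⟩⟩, hF⟩

theorem exists_mem_reflectionGroup_emb_eq_indefHerm {r : ℝ} {l : Octonion}
    (h : r ^ 2 - ‖l‖ ^ 2 = 1) :
    ∃ F ∈ reflectionGroup, ∀ p, emb (F p) = swapHerm (indefHerm r l (swapHerm (emb p))) := by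
  obtain ⟨F, hF, hext⟩ := isAdapted_chart₂.exists_extends_indefRefl dense_D₂ h
  have hL := isReflection_swapHerm.conjugate (isReflection_indefHerm h)
  exact ⟨F, Subgroup.subset_closure
    ⟨hL.isIsometry_perm hF, Or.inl ⟨r, l, h, Or.inr hext⟩⟩, hF⟩

theorem diag₂_euclHerm_outer_one (r : ℝ) (u v : Octonion) :
    diag₂ (euclHerm r (r • conj u) (outer 1 u v)) = 0 := by
  simp only [euclHerm, outer, LinearMap.coe_mk, AddHom.coe_mk, diag₁_mk, diag₂_mk, entry₁₂_mk,
    norm_sq_smul_conj, one_mul, norm_one', real_inner_smul_left, real_inner_self_eq_norm_sq,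
    norm_conj]
  ring

theorem diag₃_indefHerm_outer_one (r : ℝ) (u v : Octonion) :
    diag₃ (indefHerm r (r • conj v) (outer u 1 v)) = 0 := by
  simp only [indefHerm, outer, LinearMap.coe_mk, AddHom.coe_mk, diag₂_mk, diag₃_mk, entry₂₃_mk,
    norm_sq_smul_conj, one_mul, norm_one', real_inner_smul_left, real_inner_self_eq_norm_sq,
    norm_conj]
  ring

theorem exists_mem_reflectionGroup_notMem_D₂ (p : OP11) : ∃ F ∈ reflectionGroup, F p ∉ D₂ := by
  by_cases hp : p ∈ D₁
  · obtain ⟨⟨⟨u, v⟩, huv⟩, rfl⟩ := mem_D₁.1 hp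
    obtain ⟨r, hr⟩ := exists_sq_mul_eq_one (a := 1 + ‖u‖ ^ 2) (by positivity)
    obtain ⟨F, hFmem, hF⟩ := exists_mem_reflectionGroup_emb_eq_euclHerm (r := r) (l := r • conj u)
      (by rw [norm_sq_smul_conj, ← hr]; ring)
    refine ⟨F, hFmem, fun h => mem_D₂_iff.1 h ?_⟩
    rw [hF, emb_pt₁, lineProj, map_smul, map_smul, diag₂_euclHerm_outer_one, smul_zero]
  · obtain ⟨F, hFmem, hF⟩ := exists_mem_reflectionGroup_emb_eq_euclHerm (r := 0) (l := 1)
      (by norm_num [norm_one'])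
    refine ⟨F, hFmem, fun h => mem_D₂_iff.1 h ?_⟩
    have hdiag : diag₂ (euclHerm 0 1 (emb p)) = diag₁ (emb p) := by
      simp [euclHerm, norm_one']
    rw [hF, hdiag, ← not_ne_iff, ← mem_D₁_iff]
    exact hp

/-- The point `[1, 0, 0]`. -/
def basePoint : OP11 := pt₁ ⟨0, zero_mem_target⟩

theorem exists_pt₁_eq_of_notMem_D₂ {p : OP11} (hp : p ∉ D₂) :
    ∃ (v : Octonion) (hv : ((0 : Octonion), v) ∈ target), p = pt₁ ⟨(0, v), hv⟩ := by
  obtain ⟨⟨⟨u, v⟩, huv⟩, rfl⟩ := mem_D₁.1 ((mem_D₁_or_D₂ p).resolve_right hp)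
  obtain rfl : u = 0 := not_ne_iff.1 fun hu => hp (cls_mem_D₂.2 hu)
  exact ⟨v, huv, rfl⟩

theorem eq_basePoint_of_notMem {p : OP11} (h₂ : p ∉ D₂) (h₃ : p ∉ D₃) : p = basePoint := by
  obtain ⟨v, hv, rfl⟩ := exists_pt₁_eq_of_notMem_D₂ h₂
  obtain rfl : v = 0 := not_ne_iff.1 fun hv => h₃ ⟨_, hv, rfl⟩
  rfl

theorem exists_mem_reflectionGroup_eq_basePoint_of_notMem_D₂ {p : OP11} (hp : p ∉ D₂) :
    ∃ F ∈ reflectionGroup, F p = basePoint := by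
  have hdiag₂ : diag₂ (emb p) = 0 := not_ne_iff.1 fun h => hp (mem_D₂_iff.2 h)
  obtain ⟨v, hv, rfl⟩ := exists_pt₁_eq_of_notMem_D₂ hp
  obtain ⟨r, hr⟩ := exists_sq_mul_eq_one (a := 1 - ‖v‖ ^ 2) (by simpa [target] using hv)
  obtain ⟨F, hFmem, hF⟩ := exists_mem_reflectionGroup_emb_eq_indefHerm (r := r) (l := r • conj v)
    (by rw [norm_sq_smul_conj, ← hr]; ring)
  refine ⟨F, hFmem, eq_basePoint_of_notMem (fun h => mem_D₂_iff.1 h ?_) fun h =>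
    mem_D₃_iff.1 h ?_⟩
  · rw [hF]
    exact hdiag₂
  · rw [hF, emb_pt₁, swapHerm_lineProj]
    change diag₃ (indefHerm r (r • conj v) (lineProj 0 1 v)) = 0
    rw [lineProj, map_smul, map_smul, diag₃_indefHerm_outer_one, smul_zero]

theorem exists_mem_reflectionGroup_eq_basePoint (p : OP11) :
    ∃ F ∈ reflectionGroup, F p = basePoint := by
  obtain ⟨F, hF, hFp⟩ := exists_mem_reflectionGroup_notMem_D₂ p
  obtain ⟨G, hG, hGp⟩ := exists_mem_reflectionGroup_eq_basePoint_of_notMem_D₂ hFp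
  exact ⟨G * F, mul_mem hG hF, hGp⟩

theorem reflectionGroup_transitive (p q : OP11) : ∃ F ∈ reflectionGroup, F p = q := by
  obtain ⟨F, hF, hFp⟩ := exists_mem_reflectionGroup_eq_basePoint p
  obtain ⟨G, hG, hGq⟩ := exists_mem_reflectionGroup_eq_basePoint q
  exact ⟨G⁻¹ * F, mul_mem (inv_mem hG) hF, by
    rw [Equiv.Perm.mul_apply, Equiv.Perm.inv_eq_iff_eq, hFp, hGq]⟩

end OP11

end

theorem mainTheorem10 :
    ∃ g : SemiRiemannianMetric OctPair OP11,
      OP11.IsGivenByDsSq g ∧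
      (∀ g' : SemiRiemannianMetric OctPair OP11, OP11.IsGivenByDsSq g' → g' = g) ∧
      g.HasSignature 8 8 ∧
      (∀ (r : ℝ) (l : Octonion), r ^ 2 - ‖l‖ ^ 2 = 1 →
        OP11.ExtendsToUniqueInvolutiveIsometry g OP11.D₁ OP11.φ₁ (OP11.indefRefl r l) ∧
        OP11.ExtendsToUniqueInvolutiveIsometry g OP11.D₂ OP11.φ₂ (OP11.indefRefl r l)) ∧
      (∀ (r : ℝ) (l : Octonion), r ^ 2 + ‖l‖ ^ 2 = 1 →
        OP11.ExtendsToUniqueInvolutiveIsometry g OP11.D₃ OP11.φ₃ (OP11.euclRefl r l)) ∧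
      (∀ p q : OP11, ∃ F ∈ Subgroup.closure
        {F : Equiv.Perm OP11 | g.IsIsometry F ∧ OP11.ExtendsReflection F}, F p = q) ∧
      MulAction.IsPretransitive g.isometryGroup OP11 := by
  refine ⟨OP11.metric, OP11.isGivenByDsSq_metric,
    fun g' h => OP11.eq_of_isGivenByDsSq h OP11.isGivenByDsSq_metric, OP11.hasSignature_metric,
    fun r l h => ⟨OP11.isAdapted_chart₁.indefRefl_extendsToUniqueInvolutiveIsometry
        OP11.dense_D₁ h,
      OP11.isAdapted_chart₂.indefRefl_extendsToUniqueInvolutiveIsometry OP11.dense_D₂ h⟩,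
    fun r l h => OP11.euclRefl_extendsToUniqueInvolutiveIsometry h,
    OP11.reflectionGroup_transitive, ⟨fun p q => ?_⟩⟩
  obtain ⟨F, hF, h⟩ := OP11.reflectionGroup_transitive p q
  exact ⟨⟨F, OP11.reflectionGroup_le_isometryGroup hF⟩, h⟩
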